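/- Let $U$ (ads) and $V$ (slots) be finite nonempty sets, let $E = U\times V$ be the edge set of the complete bipartite graph on $U$ and $V$, and let $v_{ij}\ge 0$ be the weight of the edge $(i,j)$. A matching is a set of pairwise disjoint edges. The dual solutions of the maximum-weight matching problem are the pairs $(u,p)$ with $u_i\ge 0$, $p_j\ge 0$ and $u_i+p_j\ge v_{ij}$ for all $(i,j)\in E$; a dual solution is optimal if it minimizes $\sum_i u_i+\sum_j p_j$, and $p$ is then called a vector of shadow prices. Let $M$ be a maximum-weight matching. The VCG price of a slot $j$ matched in $M$ to the ad $i$ is the externality of $i$, namely the maximum weight of a matching that does not use $i$, minus the total weight of the edges of $M$ other than $(i,j)$; the VCG price of a slot unmatched in $M$ is $0$. Given $v$, $M$ and a vector $p$ of shadow prices, with corresponding optimal dual solution $(u,p)$, consider the following algorithm. Let $R$ be the set of nodes covered by $M$. While $R\neq\emptyset$: let $\Delta$ be the minimum of the prices $p_j$ of the slots $j\in R$ and of the slacks $u_i+p_j-v_{ij}$ of the edges with $i\notin R$, $j\in R$; add $\Delta$ to $u_i$ for all ads $i\in R$ and subtract $\Delta$ from $p_j$ for all slots $j\in R$; then remove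 from $R$ all nodes visited by the alternating search that starts at the slots $j\in R$ with $p_j=0$ or with a tight edge ($u_i+p_j=v_{ij}$) to an ad $i\notin R$, and that proceeds from a slot to its partner in $M$ and from an ad to the slots of $R$ along tight edges. Finally return $p$. Then this algorithm terminates and returns the VCG prices, and these are the pointwise least vector of shadow prices: they are the slot part of an optimal dual solution, and every optimal dual solution has slot variables that are at least as large in every coordinate. Moreover, the algorithm can be implemented on a random access machine with unit-cost arithmetic and comparisons on real numbers (with the dual variables of the nodes in $R$ updated implicitly or explicitly) so that, from the input $v, M, p$, it runs in time $O(|E|+|V|\log|E|)$. -/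

import Mathlib

/-! ### The assignment problem on the complete bipartite graph with sides `U` (ads) and `V` (slots) -/

namespace Assignment

variable {U V : Type*} [Fintype U] [Fintype V]

/-- The value that ad `i` gets in the matching `M`. A matching of the complete bipartite graph on
`U` and `V` is a partial equivalence `U ≃. V`: `M i = some j` says that the edge `(i, j)` is used. -/
def matchedValue (v : U → V → ℝ) (M : U ≃. V) (i : U) : ℝ :=
  (M i).elim 0 (v i)

/-- The total weight (social welfare) of a matching. -/
def weight (v : U → V → ℝ) (M : U ≃. V) : ℝ :=
  ∑ i, matchedValue v M i

/-- `M` is a maximum-weight matching. -/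
def IsOptimalMatching (v : U → V → ℝ) (M : U ≃. V) : Prop :=
  ∀ M' : U ≃. V, weight v M' ≤ weight v M

/-- Feasibility for the dual linear program
`min ∑ u_i + ∑ p_j` subject to `u_i + p_j ≥ v_ij`, `u ≥ 0`, `p ≥ 0`. -/
def IsFeasibleDual (v : U → V → ℝ) (u : U → ℝ) (p : V → ℝ) : Prop :=
  (∀ i j, v i j ≤ u i + p j) ∧ (∀ i, 0 ≤ u i) ∧ ∀ j, 0 ≤ p j

/-- Optimal solutions of the dual linear program. -/
def IsOptimalDual (v : U → V → ℝ) (u : U → ℝ) (p : V → ℝ) : Prop :=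
  IsFeasibleDual v u p ∧
    ∀ u' p', IsFeasibleDual v u' p' → ∑ i, u i + ∑ j, p j ≤ ∑ i, u' i + ∑ j, p' j

/-- `p` is a vector of shadow prices: the slot part of an optimal dual solution. -/
def IsShadowPrices (v : U → V → ℝ) (p : V → ℝ) : Prop :=
  ∃ u, IsOptimalDual v u p

/-- The maximum social welfare when ad `i` is removed (a maximum over a finite nonempty set). -/
noncomputable def optimalWeightWithout (v : U → V → ℝ) (i : U) : ℝ :=
  sSup {w | ∃ M' : U ≃. V, M' i = none ∧ w = weight v M'}

open Classical in
/-- The VCG payment of ad `i` under the allocation `M`: its externality, i.e. the optimal welfare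
of the other ads without `i`, minus the welfare of the other ads under `M`. -/
noncomputable def vcgPayment (v : U → V → ℝ) (M : U ≃. V) (i : U) : ℝ :=
  optimalWeightWithout v i - ∑ i' ∈ Finset.univ.erase i, matchedValue v M i'

/-- The VCG price of a slot: the VCG payment of the ad it is allocated to; `0` for an empty slot. -/
noncomputable def vcgPrice (v : U → V → ℝ) (M : U ≃. V) (j : V) : ℝ :=
  (M.symm j).elim 0 (vcgPayment v M)

/-! ### The price-lowering algorithm -/

/-- A state of the algorithm: the dual variables and the set `R` of nodes that are not yet
immutable, as a set `RU` of ads and a set `RV` of slots. -/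
structure PState (U V : Type*) where
  u : U → ℝ
  p : V → ℝ
  RU : Set U
  RV : Set V

/-- Start: `R` is the set of nodes in the matching. -/
def startState (M : U ≃. V) (u : U → ℝ) (p : V → ℝ) : PState U V where
  u := u
  p := p
  RU := {i | M i ≠ none}
  RV := {j | M.symm j ≠ none}

/-- The quantities over which `Δ` is the minimum: the prices of the slots in `R`, and the slacks of
the edges from a slot in `R` to an ad outside `R`. -/
def candidates (v : U → V → ℝ) (s : PState U V) : Set ℝ :=
  {x | ∃ j ∈ s.RV, x = s.p j} ∪ {x | ∃ i ∉ s.RU, ∃ j ∈ s.RV, x = s.u i + s.p j - v i j}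

/-- `Δ`; the minimum of a finite set, which is nonempty whenever `R` contains a slot. -/
noncomputable def delta (v : U → V → ℝ) (s : PState U V) : ℝ :=
  sInf (candidates v s)

open Classical in
/-- Raise the utilities and lower the prices in `R` by `Δ`. -/
noncomputable def shift (v : U → V → ℝ) (s : PState U V) : PState U V where
  u := fun i => if i ∈ s.RU then s.u i + delta v s else s.u i
  p := fun j => if j ∈ s.RV then s.p j - delta v s else s.p j
  RU := s.RU
  RV := s.RV

/-- The nodes visited by the alternating search along tight edges. It starts at the slots of `R`
that have price `0` or a tight edge to an ad outside `R`; it goes from a slot to an ad along the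
matching edge, and from an ad to the slots of `R` along tight edges. -/
inductive Visited (v : U → V → ℝ) (M : U ≃. V) (s : PState U V) : U ⊕ V → Prop
  | zero {j : V} : j ∈ s.RV → s.p j = 0 → Visited v M s (Sum.inr j)
  | outside {i : U} {j : V} : i ∉ s.RU → j ∈ s.RV → s.u i + s.p j = v i j →
      Visited v M s (Sum.inr j)
  | mate {i : U} {j : V} : Visited v M s (Sum.inr j) → M i = some j → Visited v M s (Sum.inl i)
  | tight {i : U} {j : V} : Visited v M s (Sum.inl i) → j ∈ s.RV → s.u i + s.p j = v i j →
      Visited v M s (Sum.inr j)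

/-- Remove the visited nodes from `R` (they become immutable). -/
def prune (v : U → V → ℝ) (M : U ≃. V) (s : PState U V) : PState U V where
  u := s.u
  p := s.p
  RU := {i | i ∈ s.RU ∧ ¬ Visited v M s (Sum.inl i)}
  RV := {j | j ∈ s.RV ∧ ¬ Visited v M s (Sum.inr j)}

/-- One iteration of the loop. -/
noncomputable def iteration (v : U → V → ℝ) (M : U ≃. V) (s : PState U V) : PState U V :=
  prune v M (shift v s)

/-- The state after `k` iterations. -/
noncomputable def stateAfter (v : U → V → ℝ) (M : U ≃. V) (u : U → ℝ) (p : V → ℝ) (k : ℕ) :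
    PState U V :=
  (iteration v M)^[k] (startState M u p)

/-- `R = ∅`. -/
def PState.Done (s : PState U V) : Prop :=
  s.RU = ∅ ∧ s.RV = ∅

/-- The loop `while R ≠ ∅` is left after exactly `k` iterations. -/
def StopsAfter (v : U → V → ℝ) (M : U ≃. V) (u : U → ℝ) (p : V → ℝ) (k : ℕ) : Prop :=
  (∀ r < k, ¬ (stateAfter v M u p r).Done) ∧ (stateAfter v M u p k).Done

end Assignment

/-! ### Machine model: a random access machine with real registers

Programs are structured programs over arrays of natural numbers (one index) and arrays of real
numbers (two indices). Every array access, every elementary operation, every test and every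
assignment costs one unit. On natural numbers there are only constants, successor, predecessor and
comparisons, so all indices stay bounded by the input size plus the running time; on real numbers
there are `0`, addition, subtraction and comparison. -/

namespace RealRam

/-- The memory. Array names are natural numbers. -/
structure Store where
  nat : ℕ → ℕ → ℕ
  real : ℕ → ℕ → ℕ → ℝ

/-- Write to an array of natural numbers. -/
def Store.setNat (σ : Store) (a k x : ℕ) : Store where
  nat := fun a' k' => if a' = a ∧ k' = k then x else σ.nat a' k'
  real := σ.real

/-- Write to an array of real numbers. -/
def Store.setReal (σ : Store) (a k l : ℕ) (x : ℝ) : Store where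
  nat := σ.nat
  real := fun a' k' l' => if a' = a ∧ k' = k ∧ l' = l then x else σ.real a' k' l'

/-- Expressions for natural numbers. -/
inductive NExp
  | lit (c : ℕ)
  | get (a : ℕ) (k : NExp)
  | succ (e : NExp)
  | pred (e : NExp)

/-- The value of an expression. -/
def NExp.eval (σ : Store) : NExp → ℕ
  | lit c => c
  | get a k => σ.nat a (k.eval σ)
  | succ e => e.eval σ + 1
  | pred e => e.eval σ - 1

/-- The number of operations for evaluating an expression. -/
def NExp.cost : NExp → ℕ
  | lit _ => 1
  | get _ k => k.cost + 1
  | succ e => e.cost + 1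
  | pred e => e.cost + 1

/-- Expressions for real numbers. -/
inductive RExp
  | zero
  | get (a : ℕ) (k l : NExp)
  | add (e f : RExp)
  | sub (e f : RExp)

/-- The value of an expression. -/
def RExp.eval (σ : Store) : RExp → ℝ
  | zero => 0
  | get a k l => σ.real a (k.eval σ) (l.eval σ)
  | add e f => e.eval σ + f.eval σ
  | sub e f => e.eval σ - f.eval σ

/-- The number of operations for evaluating an expression. -/
def RExp.cost : RExp → ℕ
  | zero => 1
  | get _ k l => k.cost + l.cost + 1
  | add e f => e.cost + f.cost + 1
  | sub e f => e.cost + f.cost + 1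

/-- Tests. -/
inductive Test
  | natEq (e f : NExp)
  | natLt (e f : NExp)
  | realLt (e f : RExp)
  | neg (b : Test)
  | conj (b c : Test)

/-- The truth of a test. -/
def Test.Holds (σ : Store) : Test → Prop
  | natEq e f => e.eval σ = f.eval σ
  | natLt e f => e.eval σ < f.eval σ
  | realLt e f => e.eval σ < f.eval σ
  | neg b => ¬ b.Holds σ
  | conj b c => b.Holds σ ∧ c.Holds σ

/-- The number of operations for evaluating a test. -/
def Test.cost : Test → ℕ
  | natEq e f => e.cost + f.cost + 1
  | natLt e f => e.cost + f.cost + 1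
  | realLt e f => e.cost + f.cost + 1
  | neg b => b.cost + 1
  | conj b c => b.cost + c.cost + 1

/-- Programs. -/
inductive Prog
  | skip
  | putNat (a : ℕ) (k e : NExp)
  | putReal (a : ℕ) (k l : NExp) (e : RExp)
  | seq (c d : Prog)
  | branch (b : Test) (c d : Prog)
  | loop (b : Test) (c : Prog)

/-- `Exec c σ σ' t`: started in memory `σ`, the program `c` halts after `t` steps in memory `σ'`. -/
inductive Exec : Prog → Store → Store → ℕ → Prop
  | skip (σ : Store) : Exec Prog.skip σ σ 1
  | putNat (a : ℕ) (k e : NExp) (σ : Store) :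
      Exec (Prog.putNat a k e) σ (σ.setNat a (k.eval σ) (e.eval σ)) (k.cost + e.cost + 1)
  | putReal (a : ℕ) (k l : NExp) (e : RExp) (σ : Store) :
      Exec (Prog.putReal a k l e) σ (σ.setReal a (k.eval σ) (l.eval σ) (e.eval σ))
        (k.cost + l.cost + e.cost + 1)
  | seq {c d : Prog} {σ₀ σ₁ σ₂ : Store} {t₁ t₂ : ℕ} :
      Exec c σ₀ σ₁ t₁ → Exec d σ₁ σ₂ t₂ → Exec (Prog.seq c d) σ₀ σ₂ (t₁ + t₂)
  | branchTrue {b : Test} {c d : Prog} {σ₀ σ₁ : Store} {t : ℕ} :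
      b.Holds σ₀ → Exec c σ₀ σ₁ t → Exec (Prog.branch b c d) σ₀ σ₁ (b.cost + t + 1)
  | branchFalse {b : Test} {c d : Prog} {σ₀ σ₁ : Store} {t : ℕ} :
      ¬ b.Holds σ₀ → Exec d σ₀ σ₁ t → Exec (Prog.branch b c d) σ₀ σ₁ (b.cost + t + 1)
  | loopDone {b : Test} {c : Prog} {σ : Store} :
      ¬ b.Holds σ → Exec (Prog.loop b c) σ σ (b.cost + 1)
  | loopStep {b : Test} {c : Prog} {σ₀ σ₁ σ₂ : Store} {t₁ t₂ : ℕ} :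
      b.Holds σ₀ → Exec c σ₀ σ₁ t₁ → Exec (Prog.loop b c) σ₁ σ₂ t₂ →
        Exec (Prog.loop b c) σ₀ σ₂ (b.cost + t₁ + t₂ + 1)

end RealRam

/-! ### Implementations of the algorithm on the machine -/

namespace Assignment

open RealRam

/-- Array of natural numbers: the numbers of ads (at `0`) and of slots (at `1`). -/
def sizeArr : ℕ := 0
/-- Array of natural numbers: the partner of each ad, as `j + 1` for slot `j`, or `0` for none. -/
def adMateArr : ℕ := 1
/-- Array of natural numbers: the partner of each slot, as `i + 1` for ad `i`, or `0` for none. -/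
def slotMateArr : ℕ := 2
/-- Array of natural numbers: nonzero for the ads in `R`. -/
def adInRArr : ℕ := 3
/-- Array of natural numbers: nonzero for the slots in `R`. -/
def slotInRArr : ℕ := 4
/-- Array of real numbers: the weight of the edge `(i, j)`, at `(i, j)`. -/
def weightArr : ℕ := 0
/-- Array of real numbers: the price of slot `j`, at `(j, 0)`. -/
def priceArr : ℕ := 1
/-- Array of real numbers: the utility of ad `i`, at `(i, 0)`. -/
def utilityArr : ℕ := 2
/-- Array of real numbers: at `(0, 0)`, a pending change of all dual variables in `R`. -/
def pendingArr : ℕ := 3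

/-- The memory that holds the input: the sizes, the weights, the matching and the prices. All other
cells are `0`. -/
noncomputable def inputStore {n m : ℕ} (v : Fin n → Fin m → ℝ) (M : Fin n ≃. Fin m)
    (p : Fin m → ℝ) : Store where
  nat := fun a k =>
    if a = sizeArr then (if k = 0 then n else if k = 1 then m else 0)
    else if a = adMateArr then
      (if h : k < n then (M ⟨k, h⟩).elim 0 (fun j => (j : ℕ) + 1) else 0)
    else if a = slotMateArr then
      (if h : k < m then (M.symm ⟨k, h⟩).elim 0 (fun i => (i : ℕ) + 1) else 0)
    else 0
  real := fun a k l =>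
    if a = weightArr then (if h : k < n ∧ l < m then v ⟨k, h.1⟩ ⟨l, h.2⟩ else 0)
    else if a = priceArr then (if h : k < m ∧ l = 0 then p ⟨k, h.1⟩ else 0)
    else 0

open Classical in
/-- The memory `σ` represents the state `s`. The dual variables are stored implicitly: for the nodes
in `R` the pending change has to be added to the stored utility and subtracted from the stored
price. -/
def Represents {n m : ℕ} (σ : Store) (s : PState (Fin n) (Fin m)) : Prop :=
  (∀ i : Fin n, σ.nat adInRArr i ≠ 0 ↔ i ∈ s.RU) ∧
  (∀ j : Fin m, σ.nat slotInRArr j ≠ 0 ↔ j ∈ s.RV) ∧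
  (∀ i : Fin n, s.u i =
    σ.real utilityArr i 0 + if i ∈ s.RU then σ.real pendingArr 0 0 else 0) ∧
  (∀ j : Fin m, s.p j =
    σ.real priceArr j 0 - if j ∈ s.RV then σ.real pendingArr 0 0 else 0)

/-- A program of the form `setup; while guard do body; finish`. -/
structure LoopProgram where
  setup : Prog
  guard : Test
  body : Prog
  finish : Prog

/-- The whole program. -/
def LoopProgram.program (A : LoopProgram) : Prog :=
  Prog.seq A.setup (Prog.seq (Prog.loop A.guard A.body) A.finish)

/-- From memory `σ₀`, the program `A` runs through exactly `k` executions of its loop body and halts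
in memory `σ₁`; for all `r ≤ k`, the memory after `r` executions of the body represents `s r`. -/
def LoopProgram.Simulates {n m : ℕ} (A : LoopProgram) (σ₀ σ₁ : Store) (k : ℕ)
    (s : ℕ → PState (Fin n) (Fin m)) : Prop :=
  ∃ σ : ℕ → Store,
    (∃ t, Exec A.setup σ₀ (σ 0) t) ∧
    (∀ r < k, A.guard.Holds (σ r) ∧ ∃ t, Exec A.body (σ r) (σ (r + 1)) t) ∧
    ¬ A.guard.Holds (σ k) ∧
    (∃ t, Exec A.finish (σ k) σ₁ t) ∧
    ∀ r ≤ k, Represents (σ r) (s r)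

end Assignment

open Assignment RealRam

/-! ### Linear programming duality for the assignment problem -/

namespace Assignment

/-! The gap between a dual objective and the weight of a matching is a sum of nonnegative slacks
(`sum_sub_weight`). Strong duality comes from Hall's theorem on the tight edges of a padded square
instance: a Hall violator would allow a dual shift that lowers the objective
(`IsOptimalDual.exists_weight_eq`). Hence every optimal dual is complementary slack to every optimal
matching.

Weak duality without ad `i` bounds `u i` by the marginal contribution of `i` in every optimal dual.
Adding one slot that is worth exactly this contribution to `i` leaves the optimum unchanged, so some
optimal dual attains the bound (`exists_isOptimalDual_marginal`). Optimal prices lying below all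
others must therefore be the VCG prices.

The algorithm keeps the dual optimal and keeps it extreme outside `R`: prices there are minimal and
utilities maximal among all optimal duals (`Invariant`). Zero prices are extreme, and extremeness
spreads along tight edges and matching edges, which is exactly what the search follows
(`Invariant.extreme_of_visited`). Each shift creates a place for the search to start, so `R` shrinks
until all prices are minimal.

The implementation stores for each slot of `R` a key, the largest decrease that its price allows.
The search repeatedly removes a slot with key zero together with its mate and relaxes the other
keys; the order does not matter (`IsPartialPrune.eq_prune`). Linear scans suffice: each removed pair
pays `O(n + m)`, there are at most `min n m` pairs, and so everything is `O(n * m)`, with the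
logarithmic term to spare. -/

theorem IsFeasibleDual.adGap_nonneg {U V : Type*} {v : U → V → ℝ} {u : U → ℝ} {p : V → ℝ}
    (h : IsFeasibleDual v u p) (M : U ≃. V) (i : U) :
    0 ≤ (M i).elim (u i) (fun j => u i + p j - v i j) := by
  cases M i with
  | none => exact h.2.1 i
  | some j => have := h.1 i j; simp; linarith

theorem IsFeasibleDual.slotGap_nonneg {U V : Type*} {v : U → V → ℝ} {u : U → ℝ} {p : V → ℝ}
    (h : IsFeasibleDual v u p) (M : U ≃. V) (j : V) :
    0 ≤ (M.symm j).elim (p j) (fun _ => (0 : ℝ)) := by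
  cases M.symm j with
  | none => exact h.2.2 j
  | some j => simp

theorem nonempty_weightsWithout {U V : Type*} [Fintype U] (v : U → V → ℝ) (i : U) :
    {w | ∃ M' : U ≃. V, M' i = none ∧ w = weight v M'}.Nonempty :=
  ⟨_, ⊥, rfl, rfl⟩

theorem vcgPayment_eq {U V : Type*} [Fintype U] (v : U → V → ℝ) (M : U ≃. V) (i : U) :
    vcgPayment v M i = optimalWeightWithout v i - weight v M + matchedValue v M i := by
  classical
  have := Finset.add_sum_erase Finset.univ (matchedValue v M) (Finset.mem_univ i)
  unfold vcgPayment weight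
  rw [← this]
  -- The two erasures differ only in their decidability instance.
  have e : ∑ i' ∈ Finset.univ.erase i, matchedValue v M i' =
    ∑ i' ∈ @Finset.erase U (fun a b => Classical.propDecidable _) Finset.univ i,
      matchedValue v M i' := by congr!
  rw [← e]
  ring

section Duality

variable {U V : Type*} [Fintype U] [Fintype V]

/-- Both sides count `f j` once for every matching edge ending at `j`. -/
theorem sum_partner_eq (M : U ≃. V) (f : V → ℝ) :
    ∑ i, (M i).elim 0 f = ∑ j, (M.symm j).elim 0 (fun _ => f j) := by
  classical
  have h1 : ∀ i, (M i).elim 0 f = ∑ j, if M i = some j then f j else 0 := by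
    intro i
    cases h : M i with
    | none => simp
    | some j => simp
  have h2 : ∀ j, (M.symm j).elim 0 (fun _ => f j) = ∑ i, if M i = some j then f j else 0 := by
    intro j
    cases h : M.symm j with
    | none =>
      have : ∀ i, M i ≠ some j := by
        intro i hi
        have := (PEquiv.eq_some_iff M).2 hi
        simp [h] at this
      simp [this]
    | some i =>
      have : ∀ i', M i' = some j ↔ i' = i := by
        intro i'
        rw [← PEquiv.eq_some_iff M, h]
        simp [eq_comm]
      simp [this]
  simp only [h1, h2]
  exact Finset.sum_comm

/-- The duality gap as a sum of slacks. -/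
theorem sum_sub_weight (v : U → V → ℝ) (M : U ≃. V) (u : U → ℝ) (p : V → ℝ) :
    ∑ i, u i + ∑ j, p j - weight v M =
      ∑ i, (M i).elim (u i) (fun j => u i + p j - v i j) +
        ∑ j, (M.symm j).elim (p j) (fun _ => 0) := by
  have h1 : ∀ i, (M i).elim (u i) (fun j => u i + p j - v i j) =
      u i + (M i).elim 0 p - matchedValue v M i := by
    intro i
    unfold matchedValue
    cases M i <;> simp
  have h2 : ∀ j, (M.symm j).elim (p j) (fun _ => (0 : ℝ)) =
      p j - (M.symm j).elim 0 (fun _ => p j) := by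
    intro j
    cases M.symm j <;> simp
  simp only [h1, h2, Finset.sum_sub_distrib, Finset.sum_add_distrib, sum_partner_eq, weight]
  ring

/-- Complementary slackness. -/
structure CompSlack (v : U → V → ℝ) (M : U ≃. V) (u : U → ℝ) (p : V → ℝ) : Prop where
  edge : ∀ {i j}, M i = some j → u i + p j = v i j
  ad : ∀ {i}, M i = none → u i = 0
  slot : ∀ {j}, M.symm j = none → p j = 0

variable {v : U → V → ℝ} {M : U ≃. V} {u : U → ℝ} {p : V → ℝ}

theorem IsFeasibleDual.weight_le (h : IsFeasibleDual v u p) (M : U ≃. V) :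
    weight v M ≤ ∑ i, u i + ∑ j, p j := by
  have := sum_sub_weight v M u p
  have h1 := Finset.sum_nonneg fun i (_ : i ∈ Finset.univ) => h.adGap_nonneg M i
  have h2 := Finset.sum_nonneg fun i (_ : i ∈ Finset.univ) => h.slotGap_nonneg M i
  linarith

/-- An unmatched ad contributes all of `u i` to the duality gap. -/
theorem IsFeasibleDual.weight_le_of_none (h : IsFeasibleDual v u p) {M : U ≃. V} {i : U}
    (hi : M i = none) : weight v M ≤ ∑ i, u i + ∑ j, p j - u i := by
  have := sum_sub_weight v M u p
  have h1 := Finset.single_le_sum (fun i (_ : i ∈ Finset.univ) => h.adGap_nonneg M i)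
    (Finset.mem_univ i)
  have h2 := Finset.sum_nonneg fun i (_ : i ∈ Finset.univ) => h.slotGap_nonneg M i
  simp only [hi, Option.elim_none] at h1
  linarith

/-- The gap is then zero, and a zero sum of nonnegative terms vanishes termwise. -/
theorem IsFeasibleDual.compSlack (h : IsFeasibleDual v u p)
    (he : ∑ i, u i + ∑ j, p j ≤ weight v M) : CompSlack v M u p := by
  have h0 := sum_sub_weight v M u p
  have h1 := Finset.sum_nonneg fun i (_ : i ∈ Finset.univ) => h.adGap_nonneg M i
  have h2 := Finset.sum_nonneg fun i (_ : i ∈ Finset.univ) => h.slotGap_nonneg M i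
  have h3 := (Finset.sum_eq_zero_iff_of_nonneg
    fun i (_ : i ∈ Finset.univ) => h.adGap_nonneg M i).1 (by linarith)
  have h4 := (Finset.sum_eq_zero_iff_of_nonneg
    fun i (_ : i ∈ Finset.univ) => h.slotGap_nonneg M i).1 (by linarith)
  refine ⟨fun {i j} hij => ?_, fun {i} hi => ?_, fun {j} hj => ?_⟩
  · have := h3 i (Finset.mem_univ i)
    simp only [hij, Option.elim_some] at this
    linarith
  · simpa [hi] using h3 i (Finset.mem_univ i)
  · simpa [hj] using h4 j (Finset.mem_univ j)

theorem CompSlack.sum_eq (h : CompSlack v M u p) : ∑ i, u i + ∑ j, p j = weight v M := by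
  have h0 := sum_sub_weight v M u p
  have h1 : ∀ i, (M i).elim (u i) (fun j => u i + p j - v i j) = 0 := by
    intro i
    cases hi : M i with
    | none => exact h.ad hi
    | some j => have := h.edge hi; simp; linarith
  have h2 : ∀ j, (M.symm j).elim (p j) (fun _ => (0 : ℝ)) = 0 := by
    intro j
    cases hj : M.symm j with
    | none => exact h.slot hj
    | some j => simp
  simp only [h1, h2, Finset.sum_const_zero] at h0
  linarith

theorem CompSlack.isOptimalDual (h : CompSlack v M u p) (hf : IsFeasibleDual v u p) :
    IsOptimalDual v u p :=
  ⟨hf, fun _ _ h' => h.sum_eq ▸ h'.weight_le M⟩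

/-- Compactness: a feasible dual at least as good as a constant one has all its coordinates in `[0,
D]`, so a minimum over the compact set `K` is global. -/
theorem exists_isOptimalDual [Nonempty U] (v : U → V → ℝ) : ∃ u p, IsOptimalDual v u p := by
  obtain ⟨B, hB⟩ : ∃ B : ℝ, ∀ i j, v i j ≤ B := by
    obtain ⟨B, hB⟩ := (Set.finite_range fun x : U × V => v x.1 x.2).bddAbove
    exact ⟨B, fun i j => hB ⟨(i, j), rfl⟩⟩
  have h0 : IsFeasibleDual v (fun _ => max B 0) (fun _ => 0) :=
    ⟨fun i j => by simpa using Or.inl (hB i j), fun _ => le_max_right _ _, fun _ => le_rfl⟩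
  set D : ℝ := ∑ _i : U, max B 0 + ∑ _j : V, (0 : ℝ) with hD
  let K : Set ((U → ℝ) × (V → ℝ)) :=
    (Set.Icc 0 (fun _ => D) ×ˢ Set.Icc 0 (fun _ => D)) ∩
      {x | ∀ i j, v i j ≤ x.1 i + x.2 j}
  have hK : IsCompact K := by
    refine (isCompact_Icc.prod isCompact_Icc).inter_right ?_
    simp only [Set.ofPred_forall]
    refine isClosed_iInter fun i => isClosed_iInter fun j => isClosed_le ?_ ?_ <;> fun_prop
  have hmem : ∀ u p, IsFeasibleDual v u p → ∑ i, u i + ∑ j, p j ≤ D → (u, p) ∈ K := by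
    intro u p h hle
    have hu := Finset.sum_nonneg fun i (_ : i ∈ Finset.univ) => h.2.1 i
    have hp := Finset.sum_nonneg fun j (_ : j ∈ Finset.univ) => h.2.2 j
    refine ⟨⟨⟨h.2.1, fun i => ?_⟩, ⟨h.2.2, fun j => ?_⟩⟩, h.1⟩
    · have := Finset.single_le_sum (fun i (_ : i ∈ Finset.univ) => h.2.1 i) (Finset.mem_univ i)
      simp only; linarith
    · have := Finset.single_le_sum (fun i (_ : i ∈ Finset.univ) => h.2.2 i) (Finset.mem_univ j)
      simp only; linarith
  obtain ⟨x, hx, hmin⟩ := hK.exists_isMinOn (f := fun x => ∑ i, x.1 i + ∑ j, x.2 j)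
    ⟨_, hmem _ _ h0 le_rfl⟩ (by fun_prop)
  refine ⟨x.1, x.2, ⟨hx.2, hx.1.1.1, hx.1.2.1⟩, fun u' p' h' => ?_⟩
  by_cases hle : ∑ i, u' i + ∑ j, p' j ≤ D
  · exact hmin (hmem _ _ h' hle)
  · have := hmin (hmem _ _ h0 le_rfl)
    simp only [Set.mem_ofPred_eq] at this
    linarith

/-- Weights of the padded square instance, in which perfect matchings correspond to matchings. -/
def padded (v : U → V → ℝ) : U ⊕ V → V ⊕ U → ℝ
  | Sum.inl i, Sum.inl j => v i j
  | _, _ => 0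

/-- Padded potentials may be negative. Moving the least potential of the dummies on each side to the
real nodes of the other side gives a feasible dual of the original problem, and replacing dummy
potentials by their minimum does not increase the sum. -/
theorem IsOptimalDual.sum_le_padded [Nonempty U] [Nonempty V] (h : IsOptimalDual v u p)
    (a : U ⊕ V → ℝ) (b : V ⊕ U → ℝ) (hab : ∀ l r, padded v l r ≤ a l + b r) :
    ∑ i, u i + ∑ j, p j ≤ ∑ l, a l + ∑ r, b r := by
  obtain ⟨j₀, hj₀⟩ := Finite.exists_min fun j => a (Sum.inr j)
  obtain ⟨i₀, hi₀⟩ := Finite.exists_min fun i => b (Sum.inr i)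
  have h0 := hab (Sum.inr j₀) (Sum.inr i₀)
  have := h.2 (fun i => a (Sum.inl i) + b (Sum.inr i₀)) (fun j => b (Sum.inl j) + a (Sum.inr j₀))
    ⟨fun i j => ?_, fun i => ?_, fun j => ?_⟩
  · refine this.trans ?_
    have e1 := Finset.sum_le_sum fun i (_ : i ∈ Finset.univ) => hi₀ i
    have e2 := Finset.sum_le_sum fun j (_ : j ∈ Finset.univ) => hj₀ j
    simp only [Fintype.sum_sum_type, Finset.sum_add_distrib]
    linarith
  · have h1 := hab (Sum.inl i) (Sum.inl j)
    simp only [padded] at h0 h1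
    linarith
  · exact hab (Sum.inl i) (Sum.inr i₀)
  · have := hab (Sum.inr j₀) (Sum.inl j)
    simp only [padded] at this
    linarith

/-- Restrict the bijection to pairs of real nodes; all other pairs weigh zero. -/
theorem exists_weight_eq_padded (v : U → V → ℝ) (e : U ⊕ V ≃ V ⊕ U) :
    ∃ N : U ≃. V, weight v N = ∑ l, padded v l (e l) := by
  refine ⟨⟨fun i => (e (Sum.inl i)).getLeft?, fun j => (e.symm (Sum.inl j)).getLeft?, ?_⟩, ?_⟩
  · intro i j
    simp only [Sum.getLeft?_eq_some_iff, Equiv.symm_apply_eq]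
    exact eq_comm
  · have : ∀ j, padded v (Sum.inr j) (e (Sum.inr j)) = 0 := fun _ => rfl
    simp only [weight, Fintype.sum_sum_type, this, Finset.sum_const_zero, add_zero]
    refine Finset.sum_congr rfl fun i _ => ?_
    simp only [matchedValue, PEquiv.coe_mk]
    cases e (Sum.inl i) <;> rfl

/-- Strong duality for the assignment problem. -/
theorem IsOptimalDual.exists_weight_eq [Nonempty U] [Nonempty V] (h : IsOptimalDual v u p) :
    ∃ N : U ≃. V, weight v N = ∑ i, u i + ∑ j, p j := by
  classical
  let a : U ⊕ V → ℝ := Sum.elim u 0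
  let b : V ⊕ U → ℝ := Sum.elim p 0
  have hsum : ∑ l, a l + ∑ r, b r = ∑ i, u i + ∑ j, p j := by simp [a, b]
  have hab : ∀ l r, padded v l r ≤ a l + b r := by
    rintro (i | j) (j' | i')
    · exact h.1.1 i j'
    · simpa [padded, a, b] using h.1.2.1 i
    · simpa [padded, a, b] using h.1.2.2 j'
    · simp [padded, a, b]
  -- Neighbours along tight edges. A perfect matching in this graph has weight equal to the dual
  -- objective.
  let t : U ⊕ V → Finset (V ⊕ U) := fun l => Finset.univ.filter fun r => a l + b r = padded v l r
  have hall : ∀ S : Finset (U ⊕ V), S.card ≤ (S.biUnion t).card := by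
    intro S
    by_contra! hlt
    let N := S.biUnion t
    -- The least slack between `S` and the complement of its neighbourhood. The default `1` on other
    -- pairs keeps `ε` positive even if there is no such pair.
    obtain ⟨x, hx⟩ := Finite.exists_min fun x : (U ⊕ V) × (V ⊕ U) =>
      if x.1 ∈ S ∧ x.2 ∉ N then a x.1 + b x.2 - padded v x.1 x.2 else 1
    set ε := if x.1 ∈ S ∧ x.2 ∉ N then a x.1 + b x.2 - padded v x.1 x.2 else 1 with hε
    have hpos : 0 < ε := by
      rw [hε]
      split_ifs with hc
      · refine lt_of_le_of_ne (sub_nonneg.2 (hab _ _)) fun h0 => hc.2 ?_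
        exact Finset.mem_biUnion.2 ⟨x.1, hc.1, by simp [t]; linarith⟩
      · exact one_pos
    have hle : ∀ l r, l ∈ S → r ∉ N → ε ≤ a l + b r - padded v l r := by
      intro l r hl hr
      have := hx (l, r)
      rwa [if_pos (show (l, r).1 ∈ S ∧ (l, r).2 ∉ N from ⟨hl, hr⟩)] at this
    -- Lowering `S` and raising its smaller neighbourhood by `ε` stays feasible but lowers the
    -- objective.
    have key := h.sum_le_padded (fun l => a l - if l ∈ S then ε else 0)
      (fun r => b r + if r ∈ N then ε else 0) (by
        intro l r
        have h1 := hab l r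
        by_cases hl : l ∈ S <;> by_cases hr : r ∈ N
        · simp only [hl, hr, if_true]; linarith
        · have := hle l r hl hr
          simp only [hl, hr, if_true, if_false]; linarith
        · simp only [hl, hr, if_true, if_false]; linarith
        · simp only [hl, hr, if_false]; linarith)
    simp only [Finset.sum_sub_distrib, Finset.sum_add_distrib, Finset.sum_ite_mem,
      Finset.univ_inter, Finset.sum_const, nsmul_eq_mul] at key
    have hc : ((N.card : ℝ)) < S.card := by exact_mod_cast hlt
    nlinarith [mul_lt_mul_of_pos_right hc hpos]
  obtain ⟨f, hf, hft⟩ := (Finset.all_card_le_biUnion_card_iff_exists_injective t).1 hall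
  have hbij : Function.Bijective f := by
    rw [Fintype.bijective_iff_injective_and_card]
    exact ⟨hf, by simp [add_comm]⟩
  let e := Equiv.ofBijective f hbij
  obtain ⟨N, hN⟩ := exists_weight_eq_padded v e
  refine ⟨N, hN.trans ?_⟩
  have : ∀ l, padded v l (e l) = a l + b (e l) := fun l =>
    ((Finset.mem_filter.1 (hft l)).2).symm
  rw [← hsum]
  simp only [this, Finset.sum_add_distrib, Equiv.sum_comp]

theorem IsOptimalDual.compSlack [Nonempty U] [Nonempty V] (h : IsOptimalDual v u p)
    (hM : IsOptimalMatching v M) : CompSlack v M u p := by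
  obtain ⟨N, hN⟩ := h.exists_weight_eq
  exact h.1.compSlack (hN ▸ hM N)

end Duality

/-! ### VCG prices and extreme optimal duals -/

section VCG

variable {U V : Type*} [Fintype U] [Fintype V]
variable {v : U → V → ℝ} {M : U ≃. V} {u : U → ℝ} {p : V → ℝ}

theorem finite_weightsWithout (v : U → V → ℝ) (i : U) :
    {w | ∃ M' : U ≃. V, M' i = none ∧ w = weight v M'}.Finite := by
  have : Finite (U ≃. V) := Finite.of_injective (fun M : U ≃. V => (M : U → Option V))
    DFunLike.coe_injective
  refine (Set.finite_range fun M' : U ≃. V => weight v M').subset ?_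
  rintro _ ⟨M', -, rfl⟩
  exact ⟨M', rfl⟩

theorem weight_le_optimalWeightWithout (v : U → V → ℝ) {M' : U ≃. V} {i : U} (h : M' i = none) :
    weight v M' ≤ optimalWeightWithout v i :=
  le_csSup (finite_weightsWithout v i).bddAbove ⟨M', h, rfl⟩

theorem IsOptimalDual.optimalWeightWithout_le [Nonempty U] [Nonempty V] (h : IsOptimalDual v u p)
    (hM : IsOptimalMatching v M) (i : U) : optimalWeightWithout v i ≤ weight v M - u i := by
  refine csSup_le (nonempty_weightsWithout v i) ?_
  rintro _ ⟨M', hi, rfl⟩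
  rw [← (h.compSlack hM).sum_eq]
  exact h.1.weight_le_of_none hi

/-- The matching induced on the slots of `V` by a matching with an extra slot. -/
def dropExtra (N : U ≃. Option V) : U ≃. V where
  toFun i := (N i).join
  invFun j := N.symm (some j)
  inv i j := by
    simp only [Option.join_eq_some_iff]
    exact PEquiv.eq_some_iff N

/-- Some optimal dual gives ad `i` its marginal contribution. -/
theorem exists_isOptimalDual_marginal [Nonempty U] [Nonempty V] (hM : IsOptimalMatching v M)
    (i : U) : ∃ u p, IsOptimalDual v u p ∧ weight v M - optimalWeightWithout v i ≤ u i := by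
  classical
  set t := weight v M - optimalWeightWithout v i with ht
  -- The extra slot `none` is worth `t` to `i` and nothing to the others.
  let w : U → Option V → ℝ := fun i' j => j.elim (if i' = i then t else 0) (v i')
  obtain ⟨u, q, hq⟩ := exists_isOptimalDual w
  obtain ⟨N, hN⟩ := hq.exists_weight_eq
  have hval : ∀ i', matchedValue w N i' =
      matchedValue v (dropExtra N) i' + if i' = i ∧ N i = some none then t else 0 := by
    intro i'
    simp only [matchedValue, dropExtra, PEquiv.coe_mk]
    by_cases hi : i' = i
    · subst hi
      rcases h : N i' with _ | _ | j <;> simp [w]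
    · rcases h : N i' with _ | _ | j <;> simp [w, hi]
  -- If `N` gives `i` the extra slot, the rest is a matching without `i`, so the total is at most
  -- `optimalWeightWithout v i + t`, which is `weight v M`. Otherwise the extra slot adds nothing.
  have hle : weight w N ≤ weight v M := by
    have hs : weight w N = weight v (dropExtra N) + if N i = some none then t else 0 := by
      unfold weight
      rw [Finset.sum_congr rfl fun i' _ => hval i', Finset.sum_add_distrib]
      by_cases h : N i = some none <;> simp [h]
    rw [hs]
    split_ifs with h
    · have : weight v (dropExtra N) ≤ optimalWeightWithout v i :=
        weight_le_optimalWeightWithout v (by simp [dropExtra, h])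
      linarith
    · simpa using hM (dropExtra N)
  have hf : IsFeasibleDual v u (fun j => q (some j)) :=
    ⟨fun i' j => hq.1.1 i' (some j), hq.1.2.1, fun j => hq.1.2.2 _⟩
  -- Weak duality for the restricted dual, combined with `hle`, forces the price of the extra slot
  -- to be zero. The restriction is thus optimal, and `hqi` becomes the bound on `u i`.
  have hw := hf.weight_le M
  have hq0 := hq.1.2.2 none
  have hqi := hq.1.1 i none
  simp only [w, Option.elim_none, if_true] at hqi
  rw [Fintype.sum_option] at hN
  refine ⟨u, _, (hf.compSlack (M := M) ?_).isOptimalDual hf, ?_⟩ <;> linarith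

/-- Optimal dual prices that lie below all others are the VCG prices. -/
theorem vcgPrice_eq_of_forall_le [Nonempty U] [Nonempty V] (hM : IsOptimalMatching v M)
    (h : IsOptimalDual v u p) (hle : ∀ u' p', IsOptimalDual v u' p' → ∀ j, p j ≤ p' j) :
    p = vcgPrice v M := by
  funext j
  unfold vcgPrice
  cases hj : M.symm j with
  | none => exact (h.compSlack hM).slot hj
  | some i =>
    have hi : M i = some j := (PEquiv.eq_some_iff M).1 hj
    obtain ⟨u', p', h', hu'⟩ := exists_isOptimalDual_marginal hM i
    have e := (h.compSlack hM).edge hi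
    have e' := (h'.compSlack hM).edge hi
    have h1 := hle u' p' h' j
    have h2 := h.optimalWeightWithout_le hM i
    simp only [Option.elim_some, vcgPayment_eq, matchedValue, hi]
    linarith

end VCG

end Assignment

namespace Assignment

/-! ### Correctness and termination of price lowering -/

section PriceLowering

variable {U V : Type*} {v : U → V → ℝ} {M : U ≃. V} {s s' : PState U V}

/-- The set `R` is a union of matching edges. -/
structure Paired (M : U ≃. V) (s : PState U V) : Prop where
  iff : ∀ {i j}, M i = some j → (i ∈ s.RU ↔ j ∈ s.RV)
  ad : ∀ {i}, M i = none → i ∉ s.RU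
  slot : ∀ {j}, M.symm j = none → j ∉ s.RV

theorem Paired.exists_mate (h : Paired M s) {j : V} (hj : j ∈ s.RV) :
    ∃ i ∈ s.RU, M i = some j := by
  cases hm : M.symm j with
  | none => exact absurd hj (h.slot hm)
  | some i =>
    have := (PEquiv.eq_some_iff M).1 hm
    exact ⟨i, (h.iff this).2 hj, this⟩

theorem Paired.done_iff (h : Paired M s) : s.Done ↔ s.RV = ∅ := by
  refine ⟨fun h => h.2, fun hV => ⟨?_, hV⟩⟩
  rw [Set.eq_empty_iff_forall_notMem] at hV ⊢
  intro i hi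
  cases hm : M i with
  | none => exact h.ad hm hi
  | some j => exact hV j ((h.iff hm).1 hi)

/-- The quantities that bound the decrease of the price of slot `j`. -/
def slotCandidates (v : U → V → ℝ) (s : PState U V) (j : V) : Set ℝ :=
  {x | x = s.p j ∨ ∃ i ∉ s.RU, x = s.u i + s.p j - v i j}

theorem mem_candidates {x : ℝ} :
    x ∈ candidates v s ↔ ∃ j ∈ s.RV, x ∈ slotCandidates v s j := by
  constructor
  · rintro (⟨j, hj, rfl⟩ | ⟨i, hi, j, hj, rfl⟩)
    · exact ⟨j, hj, Or.inl rfl⟩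
    · exact ⟨j, hj, Or.inr ⟨i, hi, rfl⟩⟩
  · rintro ⟨j, hj, rfl | ⟨i, hi, rfl⟩⟩
    · exact Or.inl ⟨j, hj, rfl⟩
    · exact Or.inr ⟨i, hi, j, hj, rfl⟩

theorem isLeast_delta [Finite U] [Finite V] (h : s.RV.Nonempty) :
    IsLeast (candidates v s) (delta v s) := by
  have hfin : (candidates v s).Finite := by
    refine ((Set.finite_range s.p).union
      (Set.finite_range fun x : U × V => s.u x.1 + s.p x.2 - v x.1 x.2)).subset ?_
    rintro _ (⟨j, -, rfl⟩ | ⟨i, -, j, -, rfl⟩)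
    · exact Or.inl ⟨j, rfl⟩
    · exact Or.inr ⟨(i, j), rfl⟩
  obtain ⟨j, hj⟩ := h
  exact ⟨Set.Nonempty.csInf_mem ⟨_, mem_candidates.2 ⟨j, hj, Or.inl rfl⟩⟩ hfin,
    fun x hx => csInf_le hfin.bddBelow hx⟩

theorem Visited.mem_RV {j : V} (h : Visited v M s (Sum.inr j)) : j ∈ s.RV := by
  cases h <;> assumption

/-- The search can enter an ad only through its own matching edge. -/
theorem visited_mate_iff {i : U} {j : V} (hm : M i = some j) :
    Visited v M s (Sum.inl i) ↔ Visited v M s (Sum.inr j) := by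
  constructor
  · rintro (_ | _ | @⟨_, j', h, hm'⟩)
    rw [hm, Option.some_inj] at hm'
    exact hm' ▸ h
  · exact fun h => h.mate hm

theorem Paired.prune (h : Paired M s) : Paired M (prune v M s) where
  iff hm := by simp only [Assignment.prune, Set.mem_ofPred_eq, h.iff hm, visited_mate_iff hm]
  ad hm hi := h.ad hm hi.1
  slot hm hj := h.slot hm hj.1

theorem Paired.shift (h : Paired M s) : Paired M (shift v s) := ⟨h.iff, h.ad, h.slot⟩

theorem paired_startState (u : U → ℝ) (p : V → ℝ) : Paired M (startState M u p) where
  iff {i j} hm := by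
    have := (PEquiv.eq_some_iff M).2 hm
    simp [startState, hm, this]
  ad hm := by simp [startState, hm]
  slot hm := by simp [startState, hm]

theorem stateAfter_succ (u : U → ℝ) (p : V → ℝ) (k : ℕ) :
    stateAfter v M u p (k + 1) = iteration v M (stateAfter v M u p k) :=
  Function.iterate_succ_apply' _ _ _

variable [Fintype U] [Fintype V]

/-- The loop invariant: the dual solution is optimal, and it is extreme on the immutable nodes. -/
structure Invariant (v : U → V → ℝ) (M : U ≃. V) (s : PState U V) : Prop where
  paired : Paired M s
  feasible : IsFeasibleDual v s.u s.p
  slack : CompSlack v M s.u s.p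
  le_price : ∀ {u' p'}, IsOptimalDual v u' p' → ∀ {j}, j ∉ s.RV → s.p j ≤ p' j
  utility_le : ∀ {u' p'}, IsOptimalDual v u' p' → ∀ {i}, i ∉ s.RU → u' i ≤ s.u i

theorem invariant_startState [Nonempty U] [Nonempty V] {u : U → ℝ} {p : V → ℝ}
    (hM : IsOptimalMatching v M) (h : IsOptimalDual v u p) :
    Invariant v M (startState M u p) where
  paired := paired_startState u p
  feasible := h.1
  slack := h.compSlack hM
  le_price {u' p'} h' j hj := by
    have : M.symm j = none := by simpa [startState] using hj
    exact ((h.compSlack hM).slot this).trans_le (h'.1.2.2 j)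
  utility_le {u' p'} h' i hi := by
    have : M i = none := by simpa [startState] using hi
    exact ((h'.compSlack hM).ad this).trans_le (h.1.2.1 i)

theorem Invariant.delta_nonneg (h : Invariant v M s) : 0 ≤ delta v s := by
  refine Real.sInf_nonneg fun x hx => ?_
  obtain ⟨j, -, rfl | ⟨i, -, rfl⟩⟩ := mem_candidates.1 hx
  · exact h.feasible.2.2 j
  · linarith [h.feasible.1 i j]

/-- Only slot prices and the slacks between ads outside `R` and slots inside can decrease, and
`delta` is at most each of them. Matching edges stay tight because both ends lie on the same side of
`R`. -/
theorem Invariant.shift (h : Invariant v M s) (hne : s.RV.Nonempty) :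
    Invariant v M (shift v s) where
  paired := h.paired.shift
  feasible := by
    have h0 := h.delta_nonneg
    have hd := (isLeast_delta (v := v) hne).2
    refine ⟨fun i j => ?_, fun i => ?_, fun j => ?_⟩
    · have hf := h.feasible.1 i j
      by_cases hi : i ∈ s.RU <;> by_cases hj : j ∈ s.RV
      · simp only [Assignment.shift, hi, hj, if_true]; linarith
      · simp only [Assignment.shift, hi, hj, if_true, if_false]; linarith
      · have := hd (Or.inr ⟨i, hi, j, hj, rfl⟩)
        simp only [Assignment.shift, hi, hj, if_true, if_false]; linarith
      · simp only [Assignment.shift, hi, hj, if_false]; linarith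
    · have := h.feasible.2.1 i
      simp only [Assignment.shift]
      split_ifs <;> linarith
    · have := h.feasible.2.2 j
      simp only [Assignment.shift]
      split_ifs with hj
      · have := hd (Or.inl ⟨j, hj, rfl⟩)
        linarith
      · linarith
  slack := by
    refine ⟨fun {i j} hm => ?_, fun {i} hm => ?_, fun {j} hm => ?_⟩
    · have := h.slack.edge hm
      by_cases hj : j ∈ s.RV
      · simp only [Assignment.shift, (h.paired.iff hm).2 hj, hj, if_true]; linarith
      · simpa only [Assignment.shift, mt (h.paired.iff hm).1 hj, hj, if_false] using this
    · simp only [Assignment.shift, h.paired.ad hm, if_false, h.slack.ad hm]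
    · simp only [Assignment.shift, h.paired.slot hm, if_false, h.slack.slot hm]
  le_price h' j hj := by
    simp only [Assignment.shift] at hj
    simpa only [Assignment.shift, hj, if_false] using h.le_price h' hj
  utility_le h' i hi := by
    simp only [Assignment.shift] at hi
    simpa only [Assignment.shift, hi, if_false] using h.utility_le h' hi

theorem Invariant.isOptimalDual (h : Invariant v M s) : IsOptimalDual v s.u s.p :=
  h.slack.isOptimalDual h.feasible

/-- Along a tight edge, maximality of `u i` gives minimality of `p j`, because any other dual
satisfies `v i j ≤ u' i + p' j`. Along a matching edge, which is tight in every optimal dual, the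
converse holds too. -/
theorem Invariant.extreme_of_visited [Nonempty U] [Nonempty V] (hM : IsOptimalMatching v M)
    (h : Invariant v M s) {u' : U → ℝ} {p' : V → ℝ} (h' : IsOptimalDual v u' p') {x : U ⊕ V}
    (hx : Visited v M s x) :
    Sum.elim (fun i => u' i ≤ s.u i) (fun j => s.p j ≤ p' j) x := by
  induction hx with
  | zero hj h0 => exact h0.trans_le (h'.1.2.2 _)
  | @outside i j hi hj ht =>
    have := h.utility_le h' hi
    have := h'.1.1 i j
    simp only [Sum.elim_inr]; linarith
  | mate _ hm ih =>
    have := h.slack.edge hm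
    have := (h'.compSlack hM).edge hm
    simp only [Sum.elim_inr, Sum.elim_inl] at *; linarith
  | @tight i j _ hj ht ih =>
    have := h'.1.1 i j
    simp only [Sum.elim_inr, Sum.elim_inl] at *; linarith

theorem Invariant.prune [Nonempty U] [Nonempty V] (hM : IsOptimalMatching v M)
    (h : Invariant v M s) : Invariant v M (prune v M s) where
  paired := h.paired.prune
  feasible := h.feasible
  slack := h.slack
  le_price h' j hj := by
    by_cases hR : j ∈ s.RV
    · have : Visited v M s (Sum.inr j) := by
        by_contra hv
        exact hj ⟨hR, hv⟩
      exact h.extreme_of_visited hM h' this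
    · exact h.le_price h' hR
  utility_le h' i hi := by
    by_cases hR : i ∈ s.RU
    · have : Visited v M s (Sum.inl i) := by
        by_contra hv
        exact hi ⟨hR, hv⟩
      exact h.extreme_of_visited hM h' this
    · exact h.utility_le h' hR

theorem Invariant.iteration [Nonempty U] [Nonempty V] (hM : IsOptimalMatching v M)
    (h : Invariant v M s) (hne : s.RV.Nonempty) : Invariant v M (iteration v M s) :=
  (h.shift hne).prune hM

/-- The minimum `delta` is attained: the shift makes a price zero or an edge to an outside ad tight.
-/
theorem exists_visited_shift (hne : s.RV.Nonempty) :
    ∃ j ∈ s.RV, Visited v M (shift v s) (Sum.inr j) := by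
  rcases (isLeast_delta (v := v) hne).1 with ⟨j, hj, hx⟩ | ⟨i, hi, j, hj, hx⟩
  · refine ⟨j, hj, Visited.zero hj ?_⟩
    simp only [shift, hj, if_true]
    linarith
  · refine ⟨j, hj, Visited.outside (i := i) hi hj ?_⟩
    simp only [shift, hj, hi, if_true, if_false]
    linarith

theorem ncard_iteration_lt (hne : s.RV.Nonempty) :
    (iteration v M s).RV.ncard < s.RV.ncard := by
  obtain ⟨j, hj, hv⟩ := exists_visited_shift (v := v) (M := M) hne
  refine Set.ncard_lt_ncard ⟨fun j hj => hj.1, fun hsub => ?_⟩ (Set.toFinite _)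
  exact (hsub hj).2 hv

theorem invariant_stateAfter [Nonempty U] [Nonempty V] {u : U → ℝ} {p : V → ℝ}
    (hM : IsOptimalMatching v M) (h : IsOptimalDual v u p) {k : ℕ}
    (hk : ∀ r < k, ¬ (stateAfter v M u p r).Done) : Invariant v M (stateAfter v M u p k) := by
  induction k with
  | zero => exact invariant_startState hM h
  | succ k ih =>
    have hi := ih fun r hr => hk r (hr.trans k.lt_succ_self)
    rw [stateAfter_succ]
    refine hi.iteration hM (Set.nonempty_iff_ne_empty.2 fun h0 => ?_)
    exact hk k k.lt_succ_self (hi.paired.done_iff.2 h0)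

theorem exists_stopsAfter [Nonempty U] [Nonempty V] {u : U → ℝ} {p : V → ℝ}
    (hM : IsOptimalMatching v M) (h : IsOptimalDual v u p) : ∃ k, StopsAfter v M u p k := by
  classical
  have hex : ∃ k, (stateAfter v M u p k).Done := by
    by_contra! hno
    have hlt : ∀ k, (stateAfter v M u p k).RV.ncard + k ≤ (stateAfter v M u p 0).RV.ncard := by
      intro k
      induction k with
      | zero => simp
      | succ k ih =>
        have hi := invariant_stateAfter hM h (k := k) fun r _ => hno r
        have := ncard_iteration_lt (v := v) (M := M)
          (Set.nonempty_iff_ne_empty.2 fun h0 => hno k (hi.paired.done_iff.2 h0))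
        rw [stateAfter_succ]
        omega
    have := hlt ((stateAfter v M u p 0).RV.ncard + 1)
    omega
  exact ⟨Nat.find hex, fun r hr => Nat.find_min hex hr, Nat.find_spec hex⟩

theorem StopsAfter.isOptimalDual [Nonempty U] [Nonempty V] {u : U → ℝ} {p : V → ℝ} {k : ℕ}
    (hk : StopsAfter v M u p k) (hM : IsOptimalMatching v M) (h : IsOptimalDual v u p) :
    IsOptimalDual v (stateAfter v M u p k).u (stateAfter v M u p k).p :=
  (invariant_stateAfter hM h hk.1).isOptimalDual

theorem StopsAfter.price_eq [Nonempty U] [Nonempty V] {u : U → ℝ} {p : V → ℝ} {k : ℕ}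
    (hk : StopsAfter v M u p k) (hM : IsOptimalMatching v M) (h : IsOptimalDual v u p) :
    (stateAfter v M u p k).p = vcgPrice v M :=
  vcgPrice_eq_of_forall_le hM (hk.isOptimalDual hM h) fun u' p' h' j =>
    (invariant_stateAfter hM h hk.1).le_price h' (by simp [hk.2.2])

theorem isLeast_vcgPrice [Nonempty U] [Nonempty V] (hM : IsOptimalMatching v M) :
    IsLeast {p | IsShadowPrices v p} (vcgPrice v M) := by
  obtain ⟨u, p, h⟩ := exists_isOptimalDual v
  obtain ⟨k, hk⟩ := exists_stopsAfter hM h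
  rw [← hk.price_eq hM h]
  refine ⟨⟨_, hk.isOptimalDual hM h⟩, ?_⟩
  rintro p' ⟨u', h'⟩ j
  exact (invariant_stateAfter hM h hk.1).le_price h' (by simp [hk.2.2])

end PriceLowering

/-! ### The search as a sequence of single removals -/

section PartialPrune

variable {U V : Type*} {v : U → V → ℝ} {M : U ≃. V} {s s' : PState U V}

/-- `s'` arises from `s` by removing some visited pairs. -/
structure IsPartialPrune (v : U → V → ℝ) (M : U ≃. V) (s s' : PState U V) : Prop where
  u_eq : s'.u = s.u
  p_eq : s'.p = s.p
  paired : Paired M s'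
  ad : ∀ {i}, i ∈ s'.RU → i ∈ s.RU
  slot : ∀ {j}, j ∈ s'.RV → j ∈ s.RV
  visited_ad : ∀ {i}, i ∈ s.RU → i ∉ s'.RU → Visited v M s (Sum.inl i)
  visited_slot : ∀ {j}, j ∈ s.RV → j ∉ s'.RV → Visited v M s (Sum.inr j)

theorem IsPartialPrune.refl (h : Paired M s) : IsPartialPrune v M s s :=
  ⟨rfl, rfl, h, id, id, fun h h' => absurd h h', fun h h' => absurd h h'⟩

/-- Remove a pair from `R`. -/
def PState.removePair (s : PState U V) (i : U) (j : V) : PState U V where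
  u := s.u
  p := s.p
  RU := s.RU \ {i}
  RV := s.RV \ {j}

/-- A zero candidate is a zero price or a tight edge to an ad outside the current `R`. Such an ad
was either outside from the start or removed as visited, so in each case the search on `s` reaches
`j`. -/
theorem IsPartialPrune.removePair (h : IsPartialPrune v M s s') {i : U} {j : V}
    (hm : M i = some j) (hj : j ∈ s'.RV) (h0 : 0 ∈ slotCandidates v s' j) :
    IsPartialPrune v M s (s'.removePair i j) := by
  have hv : Visited v M s (Sum.inr j) := by
    rcases h0 with h0 | ⟨i', hi', h0⟩
    · exact Visited.zero (h.slot hj) (by rw [← h.p_eq, ← h0])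
    · rw [h.u_eq, h.p_eq] at h0
      by_cases hR : i' ∈ s.RU
      · exact Visited.tight (h.visited_ad hR hi') (h.slot hj) (by linarith)
      · exact Visited.outside hR (h.slot hj) (by linarith)
  refine ⟨h.u_eq, h.p_eq, ⟨fun {i' j'} hm' => ?_, fun hi hi' => h.paired.ad hi hi'.1,
    fun hj hj' => h.paired.slot hj hj'.1⟩, fun hi => h.ad hi.1, fun hj => h.slot hj.1,
    fun {i'} hR hR' => ?_, fun {j'} hR hR' => ?_⟩
  · have : i' = i ↔ j' = j := by
      constructor
      · rintro rfl
        simpa [hm] using hm'.symm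
      · rintro rfl
        exact PEquiv.inj M hm' hm
    simp only [PState.removePair, Set.mem_sdiff, Set.mem_singleton_iff, h.paired.iff hm', this]
  · by_cases hi : i' = i
    · exact hi ▸ hv.mate hm
    · exact h.visited_ad hR fun hi' => hR' ⟨hi', hi⟩
  · by_cases hj : j' = j
    · exact hj ▸ hv
    · exact h.visited_slot hR fun hj' => hR' ⟨hj', hj⟩

/-- With all remaining candidates positive, no rule of the search leads back into the remaining set;
induction along the search shows that every visited node has been removed. -/
theorem IsPartialPrune.eq_prune (h : IsPartialPrune v M s s')
    (hpos : ∀ j ∈ s'.RV, ∀ x ∈ slotCandidates v s' j, 0 < x) : s' = prune v M s := by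
  have key : ∀ x, Visited v M s x → Sum.elim (fun i => i ∉ s'.RU) (fun j => j ∉ s'.RV) x := by
    intro x hx
    induction hx with
    | zero hj h0 =>
      intro hj'
      have := hpos _ hj' _ (Or.inl rfl)
      rw [h.p_eq] at this
      linarith
    | outside hi hj ht =>
      intro hj'
      have := hpos _ hj' _ (Or.inr ⟨_, fun hi' => hi (h.ad hi'), rfl⟩)
      rw [h.p_eq, h.u_eq] at this
      linarith
    | mate _ hm ih => exact fun hi => ih ((h.paired.iff hm).1 hi)
    | tight _ hj ht ih =>
      intro hj'
      have := hpos _ hj' _ (Or.inr ⟨_, ih, rfl⟩)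
      rw [h.p_eq, h.u_eq] at this
      linarith
  have hU : s'.RU = (prune v M s).RU := by
    ext i
    refine ⟨fun hi => ⟨h.ad hi, fun hv => key _ hv hi⟩, fun hi => ?_⟩
    by_contra hi'
    exact hi.2 (h.visited_ad hi.1 hi')
  have hV : s'.RV = (prune v M s).RV := by
    ext j
    refine ⟨fun hj => ⟨h.slot hj, fun hv => key _ hv hj⟩, fun hj => ?_⟩
    by_contra hj'
    exact hj.2 (h.visited_slot hj.1 hj')
  have hu : s'.u = (prune v M s).u := h.u_eq
  have hp : s'.p = (prune v M s).p := h.p_eq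
  calc s' = ⟨s'.u, s'.p, s'.RU, s'.RV⟩ := rfl
    _ = prune v M s := by rw [hu, hp, hU, hV]

end PartialPrune

end Assignment

/-! ### Frames, weakest preconditions and time bounds for programs -/

namespace RealRam

theorem Store.setNat_nat_self (σ : Store) (a k x k' : ℕ) :
    (σ.setNat a k x).nat a k' = if k' = k then x else σ.nat a k' := by
  simp [Store.setNat]

theorem Store.setNat_nat_of_ne (σ : Store) {a a' : ℕ} (k x : ℕ) (h : a' ≠ a) :
    (σ.setNat a k x).nat a' = σ.nat a' := by
  simp [Store.setNat, h]

theorem Store.setNat_real (σ : Store) (a k x : ℕ) : (σ.setNat a k x).real = σ.real := rfl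

theorem Store.setReal_real_self (σ : Store) (a k l : ℕ) (x : ℝ) (k' l' : ℕ) :
    (σ.setReal a k l x).real a k' l' = if k' = k ∧ l' = l then x else σ.real a k' l' := by
  simp [Store.setReal]

theorem Store.setReal_real_of_ne (σ : Store) {a a' : ℕ} (k l : ℕ) (x : ℝ) (h : a' ≠ a) :
    (σ.setReal a k l x).real a' = σ.real a' := by
  simp [Store.setReal, h]

theorem Store.setReal_nat (σ : Store) (a k l : ℕ) (x : ℝ) : (σ.setReal a k l x).nat = σ.nat := rfl

/-- `σ'` agrees with `σ` outside the arrays `A` of natural and `B` of real numbers. -/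
structure Frame (A B : List ℕ) (σ σ' : Store) : Prop where
  nat : ∀ {a}, a ∉ A → σ'.nat a = σ.nat a
  real : ∀ {b}, b ∉ B → σ'.real b = σ.real b

theorem Frame.refl (A B : List ℕ) (σ : Store) : Frame A B σ σ := ⟨fun _ => rfl, fun _ => rfl⟩

theorem Frame.trans {A B : List ℕ} {σ₀ σ₁ σ₂ : Store} (h : Frame A B σ₀ σ₁)
    (h' : Frame A B σ₁ σ₂) : Frame A B σ₀ σ₂ :=
  ⟨fun ha => (h'.nat ha).trans (h.nat ha), fun hb => (h'.real hb).trans (h.real hb)⟩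

theorem Frame.mono {A A' B B' : List ℕ} {σ σ' : Store} (h : Frame A B σ σ') (hA : A ⊆ A')
    (hB : B ⊆ B') : Frame A' B' σ σ' :=
  ⟨fun ha => h.nat fun h' => ha (hA h'), fun hb => h.real fun h' => hb (hB h')⟩

theorem Frame.setNat {A B : List ℕ} {σ σ' : Store} (h : Frame A B σ σ') {a : ℕ} (ha : a ∈ A)
    (k x : ℕ) : Frame A B σ (σ'.setNat a k x) :=
  ⟨fun {a'} ha' => by
    rw [Store.setNat_nat_of_ne _ _ _ (ne_of_mem_of_not_mem ha ha').symm, h.nat ha'], fun hb => h.real hb⟩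

theorem Frame.setReal {A B : List ℕ} {σ σ' : Store} (h : Frame A B σ σ') {b : ℕ} (hb : b ∈ B)
    (k l : ℕ) (x : ℝ) : Frame A B σ (σ'.setReal b k l x) :=
  ⟨fun ha => h.nat ha, fun {b'} hb' => by
    rw [Store.setReal_real_of_ne _ _ _ _ (ne_of_mem_of_not_mem hb hb').symm, h.real hb']⟩

/-- Started in `σ`, the program halts within `t` steps in a memory that satisfies `Q`. -/
def Runs (c : Prog) (σ : Store) (t : ℕ) (Q : Store → Prop) : Prop :=
  ∃ σ' t', Exec c σ σ' t' ∧ t' ≤ t ∧ Q σ'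

theorem Runs.mono {c : Prog} {σ : Store} {t t' : ℕ} {Q Q' : Store → Prop} (h : Runs c σ t Q)
    (ht : t ≤ t') (hQ : ∀ σ', Q σ' → Q' σ') : Runs c σ t' Q' :=
  let ⟨σ', _, he, hle, hq⟩ := h
  ⟨σ', _, he, hle.trans ht, hQ _ hq⟩

theorem Runs.seq {c d : Prog} {σ : Store} {t₁ t₂ : ℕ} {Q R : Store → Prop} (h₁ : Runs c σ t₁ Q)
    (h₂ : ∀ σ', Q σ' → Runs d σ' t₂ R) : Runs (Prog.seq c d) σ (t₁ + t₂) R := by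
  obtain ⟨σ', t', he, hle, hq⟩ := h₁
  obtain ⟨σ'', t'', he', hle', hr⟩ := h₂ σ' hq
  exact ⟨σ'', _, he.seq he', Nat.add_le_add hle hle', hr⟩

theorem Runs.branch {b : Test} {c d : Prog} {σ : Store} {t : ℕ} {Q : Store → Prop}
    (h₁ : b.Holds σ → Runs c σ t Q) (h₂ : ¬ b.Holds σ → Runs d σ t Q) :
    Runs (Prog.branch b c d) σ (b.cost + t + 1) Q := by
  by_cases hb : b.Holds σ
  · obtain ⟨σ', t', he, hle, hq⟩ := h₁ hb
    exact ⟨σ', _, he.branchTrue hb, by omega, hq⟩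
  · obtain ⟨σ', t', he, hle, hq⟩ := h₂ hb
    exact ⟨σ', _, he.branchFalse hb, by omega, hq⟩

theorem Runs.loopDone {b : Test} {c : Prog} {σ : Store} {Q : Store → Prop} (hb : ¬ b.Holds σ)
    (hQ : Q σ) : Runs (Prog.loop b c) σ (b.cost + 1) Q :=
  ⟨σ, _, Exec.loopDone hb, le_rfl, hQ⟩

theorem Runs.loopStep {b : Test} {c : Prog} {σ : Store} {t₁ t₂ : ℕ} {Q R : Store → Prop}
    (hb : b.Holds σ) (h₁ : Runs c σ t₁ Q) (h₂ : ∀ σ', Q σ' → Runs (Prog.loop b c) σ' t₂ R) :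
    Runs (Prog.loop b c) σ (b.cost + t₁ + t₂ + 1) R := by
  obtain ⟨σ', t', he, hle, hq⟩ := h₁
  obtain ⟨σ'', t'', he', hle', hr⟩ := h₂ σ' hq
  exact ⟨σ'', _, Exec.loopStep hb he he', by omega, hr⟩

/-- Weakest preconditions of programs without loops. -/
def Prog.wp : Prog → (Store → Prop) → Store → Prop
  | skip, Q, σ => Q σ
  | putNat a k e, Q, σ => Q (σ.setNat a (k.eval σ) (e.eval σ))
  | putReal a k l e, Q, σ => Q (σ.setReal a (k.eval σ) (l.eval σ) (e.eval σ))
  | seq c d, Q, σ => c.wp (d.wp Q) σ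
  | branch b c d, Q, σ => (b.Holds σ → c.wp Q σ) ∧ (¬ b.Holds σ → d.wp Q σ)
  | loop _ _, _, _ => False

/-- A bound for the running time of programs without loops. -/
def Prog.bound : Prog → ℕ
  | skip => 1
  | putNat _ k e => k.cost + e.cost + 1
  | putReal _ k l e => k.cost + l.cost + e.cost + 1
  | seq c d => c.bound + d.bound
  | branch b c d => b.cost + (c.bound + d.bound) + 1
  | loop _ _ => 0

/-- Loops have the precondition `False`, so their meaningless `bound` is never used. -/
theorem runs_of_wp {c : Prog} {σ : Store} {Q : Store → Prop} (h : c.wp Q σ) :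
    Runs c σ c.bound Q := by
  induction c generalizing σ Q with
  | skip => exact ⟨σ, _, Exec.skip σ, le_rfl, h⟩
  | putNat a k e => exact ⟨_, _, Exec.putNat a k e σ, le_rfl, h⟩
  | putReal a k l e => exact ⟨_, _, Exec.putReal a k l e σ, le_rfl, h⟩
  | seq c d hc hd => exact (hc h).seq fun σ' h' => hd h'
  | branch b c d hc hd =>
    exact Runs.branch (fun hb => (hc (h.1 hb)).mono (Nat.le_add_right _ _) fun _ => id)
      fun hb => (hd (h.2 hb)).mono (Nat.le_add_left _ _) fun _ => id
  | loop b c => exact h.elim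

/-- `for x := 0 to bound - 1 do body`, where `x` is cell `0` of the array `a`. -/
def forLoop (a : ℕ) (bound : NExp) (body : Prog) : Prog :=
  Prog.seq (Prog.putNat a (NExp.lit 0) (NExp.lit 0))
    (Prog.loop (Test.natLt (NExp.get a (NExp.lit 0)) bound)
      (Prog.seq body (Prog.putNat a (NExp.lit 0) (NExp.succ (NExp.get a (NExp.lit 0))))))

/-- The invariant `I (k + 1)` is required in the memory after the counter has been incremented. Each
round pays for the body, the guard and the increment. -/
theorem runs_forLoop {a : ℕ} {bound : NExp} {body : Prog} {σ : Store} {t N : ℕ}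
    (I : ℕ → Store → Prop) (hI : ∀ k σ, I k σ → σ.nat a 0 = k ∧ bound.eval σ = N)
    (h0 : I 0 (σ.setNat a 0 0))
    (hstep : ∀ k < N, ∀ σ, I k σ →
      Runs body σ t fun σ' => σ'.nat a 0 = k ∧ I (k + 1) (σ'.setNat a 0 (k + 1))) :
    Runs (forLoop a bound body) σ ((t + bound.cost + 9) * N + bound.cost + 7) (I N) := by
  have hloop : ∀ r k σ, k + r = N → I k σ →
      Runs (Prog.loop (Test.natLt (NExp.get a (NExp.lit 0)) bound)
        (Prog.seq body (Prog.putNat a (NExp.lit 0) (NExp.succ (NExp.get a (NExp.lit 0))))))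
        σ ((t + bound.cost + 9) * r + bound.cost + 4) (I N) := by
    intro r
    induction r with
    | zero =>
      intro k σ hk h
      obtain rfl : k = N := by omega
      have := hI _ _ h
      exact (Runs.loopDone (by simp [Test.Holds, NExp.eval, this]) h).mono
        (by simp [Test.cost, NExp.cost]; omega) fun _ => id
    | succ r ih =>
      intro k σ hk h
      have := hI _ _ h
      refine (Runs.loopStep (by simp [Test.Holds, NExp.eval, this]; omega)
        (((hstep k (by omega) σ h).seq (R := I (k + 1)) fun σ' h' => runs_of_wp ?_))
        fun σ' h' => ih (k + 1) σ' (by omega) h').mono ?_ fun _ => id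
      · simpa [Prog.wp, NExp.eval, h'.1] using h'.2
      · simp only [Prog.bound, Test.cost, NExp.cost, Nat.mul_succ]
        omega
  refine (Runs.seq (Q := I 0) (runs_of_wp ?_) fun σ' h' => hloop N 0 σ' (by omega) h').mono
    ?_ fun _ => id
  · simpa [Prog.wp, NExp.eval] using h0
  · simp only [Prog.bound, NExp.cost]
    omega

end RealRam

/-! ### The program -/

namespace Assignment

open RealRam

/-- Array of natural numbers: at `0`, a slot of `R` with the smallest key, or the number of slots. -/
def bestArr : ℕ := 5
/-- Array of natural numbers: at `0`, a loop counter for slots. -/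
def slotArr : ℕ := 6
/-- Array of natural numbers: at `0`, a loop counter for ads. -/
def adArr : ℕ := 7
/-- Array of natural numbers: at `0`, the ad that has left `R`. -/
def leavingArr : ℕ := 8
/-- Array of real numbers: for the slots `j` in `R`, at `(j, 0)`, the largest possible decrease of
the price of `j`. -/
def keyArr : ℕ := 4
/-- Array of real numbers: at `(0, 0)`, the decrease of the prices in this iteration. -/
def deltaArr : ℕ := 5

/-- The value of a variable. -/
abbrev cell (a : ℕ) : NExp := NExp.get a (NExp.lit 0)

/-- The entry of a one-dimensional array of real numbers. -/
abbrev entry (a : ℕ) (k : NExp) : RExp := RExp.get a k (NExp.lit 0)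

abbrev numAds : NExp := NExp.get sizeArr (NExp.lit 0)
abbrev numSlots : NExp := NExp.get sizeArr (NExp.lit 1)

/-- `e` is nonzero. -/
abbrev nonzero (e : NExp) : Test := Test.neg (Test.natEq e (NExp.lit 0))

abbrev slackExp : RExp :=
  RExp.sub (RExp.add (entry utilityArr (cell leavingArr)) (entry priceArr (cell slotArr)))
    (RExp.get weightArr (cell leavingArr) (cell slotArr))

/-- Update the keys of the slots in `R` after an ad has left `R`. -/
def relaxAll : Prog :=
  forLoop slotArr numSlots
    (Prog.branch (nonzero (NExp.get slotInRArr (cell slotArr)))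
      (Prog.branch (Test.realLt slackExp (entry keyArr (cell slotArr)))
        (Prog.putReal keyArr (cell slotArr) (NExp.lit 0) slackExp) Prog.skip)
      Prog.skip)

/-- Find a slot of `R` with the smallest key. -/
def selectMin : Prog :=
  Prog.seq (Prog.putNat bestArr (NExp.lit 0) numSlots)
    (forLoop slotArr numSlots
      (Prog.branch
        (Test.conj (nonzero (NExp.get slotInRArr (cell slotArr)))
          (Test.neg (Test.conj (Test.natLt (cell bestArr) numSlots)
            (Test.neg (Test.realLt (entry keyArr (cell slotArr)) (entry keyArr (cell bestArr)))))))
        (Prog.putNat bestArr (NExp.lit 0) (cell slotArr)) Prog.skip))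

/-- Keys drop together with prices, since ads outside `R` keep their utilities. -/
def lowerPrices : Prog :=
  forLoop slotArr numSlots
    (Prog.branch (nonzero (NExp.get slotInRArr (cell slotArr)))
      (Prog.seq
        (Prog.putReal priceArr (cell slotArr) (NExp.lit 0)
          (RExp.sub (entry priceArr (cell slotArr)) (entry deltaArr (NExp.lit 0))))
        (Prog.putReal keyArr (cell slotArr) (NExp.lit 0)
          (RExp.sub (entry keyArr (cell slotArr)) (entry deltaArr (NExp.lit 0)))))
      Prog.skip)

def raiseUtilities : Prog :=
  forLoop adArr numAds
    (Prog.branch (nonzero (NExp.get adInRArr (cell adArr)))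
      (Prog.putReal utilityArr (cell adArr) (NExp.lit 0)
        (RExp.add (entry utilityArr (cell adArr)) (entry deltaArr (NExp.lit 0))))
      Prog.skip)

def initSlots : Prog :=
  forLoop slotArr numSlots
    (Prog.branch (nonzero (NExp.get slotMateArr (cell slotArr)))
      (Prog.seq
        (Prog.putNat slotInRArr (cell slotArr) (NExp.lit 1))
        (Prog.putReal keyArr (cell slotArr) (NExp.lit 0) (entry priceArr (cell slotArr))))
      Prog.skip)

abbrev mateExp : NExp := NExp.pred (NExp.get adMateArr (cell adArr))

/-- Utilities are not part of the input, but complementary slackness determines them: `v i j - p j`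
for a matched ad and `0`, the initial memory content, for an unmatched one. Unmatched ads are
treated like ads that leave `R`. -/
def initAds : Prog :=
  forLoop adArr numAds
    (Prog.branch (nonzero (NExp.get adMateArr (cell adArr)))
      (Prog.seq
        (Prog.putNat adInRArr (cell adArr) (NExp.lit 1))
        (Prog.putReal utilityArr (cell adArr) (NExp.lit 0)
          (RExp.sub (RExp.get weightArr (cell adArr) mateExp) (entry priceArr mateExp))))
      (Prog.seq (Prog.putNat leavingArr (NExp.lit 0) (cell adArr)) relaxAll))

/-- Remove the selected slot and its partner from `R`. -/
def removeBest : Prog :=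
  Prog.seq
    (Prog.putNat leavingArr (NExp.lit 0) (NExp.pred (NExp.get slotMateArr (cell bestArr))))
    (Prog.seq (Prog.putNat slotInRArr (cell bestArr) (NExp.lit 0))
      (Prog.putNat adInRArr (cell leavingArr) (NExp.lit 0)))

/-- Keys are nonnegative by dual feasibility, so this tests whether the least key is zero. -/
def removeTest : Test :=
  Test.conj (Test.natLt (cell bestArr) numSlots)
    (Test.neg (Test.realLt RExp.zero (entry keyArr (cell bestArr))))

def removeVisited : Prog :=
  Prog.loop removeTest (Prog.seq removeBest (Prog.seq relaxAll selectMin))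

def shiftProg : Prog :=
  Prog.seq (Prog.putReal deltaArr (NExp.lit 0) (NExp.lit 0) (entry keyArr (cell bestArr)))
    (Prog.seq lowerPrices raiseUtilities)

/-- The implementation of the algorithm by linear scans. -/
def priceLowering : LoopProgram where
  setup := Prog.seq initSlots (Prog.seq initAds selectMin)
  guard := Test.natLt (cell bestArr) numSlots
  body := Prog.seq shiftProg removeVisited
  finish := Prog.skip

/-! ### Specifications of the scans -/

section Specs

attribute [local simp] Store.setNat_nat_self Store.setNat_nat_of_ne Store.setNat_real
  Store.setReal_real_self Store.setReal_real_of_ne Store.setReal_nat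
  sizeArr adMateArr slotMateArr adInRArr slotInRArr weightArr priceArr utilityArr pendingArr
  bestArr slotArr adArr leavingArr keyArr deltaArr

theorem runs_relaxAll {σ : Store} {m : ℕ} (hm : σ.nat sizeArr 1 = m) :
    Runs relaxAll σ (100 * (m + 1)) fun σ' => Frame [slotArr] [keyArr] σ σ' ∧
      ∀ j < m, σ.nat slotInRArr j ≠ 0 → σ'.real keyArr j 0 = min (σ.real keyArr j 0)
        (σ.real utilityArr (σ.nat leavingArr 0) 0 + σ.real priceArr j 0 -
          σ.real weightArr (σ.nat leavingArr 0) j) := by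
  refine (runs_forLoop (N := m) (fun k σ' => σ'.nat slotArr 0 = k ∧
      Frame [slotArr] [keyArr] σ σ' ∧
      ∀ j, σ.nat slotInRArr j ≠ 0 → σ'.real keyArr j 0 = if j < k then min (σ.real keyArr j 0)
        (σ.real utilityArr (σ.nat leavingArr 0) 0 + σ.real priceArr j 0 -
          σ.real weightArr (σ.nat leavingArr 0) j) else σ.real keyArr j 0)
      ?_ ?_ fun k hkm σ' h => runs_of_wp ?_).mono ?_ ?_
  · rintro k σ' ⟨h1, hF, -⟩
    refine ⟨h1, ?_⟩
    rw [NExp.eval, hF.nat (by decide)]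
    exact hm
  · exact ⟨by simp, (Frame.refl _ _ _).setNat (by decide) _ _, by simp⟩
  · obtain ⟨h1, hF, h4⟩ := h
    have e1 := hF.nat (a := slotInRArr) (by decide)
    have e2 := hF.nat (a := leavingArr) (by decide)
    have e3 := hF.real (b := utilityArr) (by decide)
    have e4 := hF.real (b := priceArr) (by decide)
    have e5 := hF.real (b := weightArr) (by decide)
    have hk := h4 k
    simp only [Prog.wp, Test.Holds, RExp.eval, NExp.eval, h1, e1, e2, e3, e4, e5]
    simp only [lt_irrefl, if_false] at hk
    have hother : ∀ j, j ≠ k → (j < k + 1 ↔ j < k) := fun j hj => by omega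
    refine ⟨fun hR => ⟨fun hlt => ?_, fun hlt => ?_⟩, fun hR => ?_⟩
    · refine ⟨h1, by simp, (hF.setReal (by decide) _ _ _).setNat (by decide) _ _, fun j hj => ?_⟩
      rcases eq_or_ne j k with rfl | hjk
      · rw [hk hj] at hlt
        simpa using hlt.le
      · simpa [hjk, hother j hjk] using h4 j hj
    · refine ⟨trivial, by simp, hF.setNat (by decide) _ _, fun j hj => ?_⟩
      rcases eq_or_ne j k with rfl | hjk
      · rw [hk hj, not_lt] at hlt
        simp only [Store.setNat_real, hk hj, Nat.lt_succ_self, if_true, min_eq_left hlt]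
      · simpa [hother j hjk] using h4 j hj
    · refine ⟨trivial, by simp, hF.setNat (by decide) _ _, fun j hj => ?_⟩
      rcases eq_or_ne j k with rfl | hjk
      · exact absurd hj (by simpa using hR)
      · simpa [hother j hjk] using h4 j hj
  · simp only [Prog.bound, Test.cost, RExp.cost, NExp.cost]
    omega
  · rintro σ' ⟨-, hF, h4⟩
    refine ⟨hF, fun j hj hR => ?_⟩
    rw [h4 j hR, if_pos hj]

/-- The cell of `bestArr` holds a slot of `R` with the smallest key, or `m` if there is none. -/
def Selected (m : ℕ) (σ : Store) : Prop :=
  (σ.nat bestArr 0 = m ∧ ∀ j < m, σ.nat slotInRArr j = 0) ∨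
    (σ.nat bestArr 0 < m ∧ σ.nat slotInRArr (σ.nat bestArr 0) ≠ 0 ∧
      ∀ j < m, σ.nat slotInRArr j ≠ 0 → σ.real keyArr (σ.nat bestArr 0) 0 ≤ σ.real keyArr j 0)

theorem runs_selectMin {σ : Store} {m : ℕ} (hm : σ.nat sizeArr 1 = m) :
    Runs selectMin σ (100 * (m + 1)) fun σ' => Frame [bestArr, slotArr] [] σ σ' ∧
      Selected m σ' := by
  refine (Runs.seq (Q := fun σ' => Frame [bestArr, slotArr] [] σ σ' ∧ σ'.nat bestArr 0 = m)
    (runs_of_wp ?_) fun σ₁ h₁ => (runs_forLoop (N := m) (fun k σ' => σ'.nat slotArr 0 = k ∧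
      Frame [bestArr, slotArr] [] σ σ' ∧
      ((σ'.nat bestArr 0 = m ∧ ∀ j < k, σ.nat slotInRArr j = 0) ∨
        (σ'.nat bestArr 0 < m ∧ σ.nat slotInRArr (σ'.nat bestArr 0) ≠ 0 ∧
          ∀ j < k, σ.nat slotInRArr j ≠ 0 →
            σ.real keyArr (σ'.nat bestArr 0) 0 ≤ σ.real keyArr j 0)))
      ?_ ?_ fun k hkm σ' h => runs_of_wp ?_)).mono ?_ ?_
  · refine ⟨(Frame.refl _ _ _).setNat (by decide) _ _, ?_⟩
    simp only [NExp.eval, Store.setNat_nat_self, if_true]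
    exact hm
  · rintro k σ' ⟨h1, hF, -⟩
    refine ⟨h1, ?_⟩
    rw [NExp.eval, hF.nat (by decide)]
    exact hm
  · refine ⟨by simp, h₁.1.setNat (by decide) _ _, Or.inl ⟨?_, by simp⟩⟩
    rw [Store.setNat_nat_of_ne _ _ _ (by decide)]
    exact h₁.2
  · obtain ⟨h1, hF, h4⟩ := h
    have e1 := hF.nat (a := slotInRArr) (by decide)
    have e2 := hF.nat (a := sizeArr) (by decide)
    have e3 := hF.real (b := keyArr) (by decide)
    simp only [Prog.wp, Test.Holds, RExp.eval, NExp.eval, h1, e1, e2, e3, hm]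
    refine ⟨fun hR => ?_, fun hR => ?_⟩
    · refine ⟨by simpa using h1, by simp,
        (hF.setNat (by decide) _ _).setNat (by decide) _ _, Or.inr ?_⟩
      have e4 : ((σ'.setNat bestArr 0 k).setNat slotArr 0 (k + 1)).nat bestArr 0 = k := by simp
      rw [e4]
      refine ⟨hkm, hR.1, fun j hj hjR => ?_⟩
      rcases eq_or_ne j k with rfl | hjk
      · exact le_rfl
      · have hjk' : j < k := by omega
        rcases h4 with h4 | h4
        · exact absurd (h4.2 j hjk') hjR
        · have h5 : σ.real keyArr k 0 < σ.real keyArr (σ'.nat bestArr 0) 0 := by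
            by_contra hlt
            exact hR.2 ⟨h4.1, hlt⟩
          exact h5.le.trans (h4.2.2 j hjk' hjR)
    · refine ⟨trivial, by simp, hF.setNat (by decide) _ _, ?_⟩
      rw [Store.setNat_nat_of_ne _ _ _ (by decide)]
      refine h4.imp (fun h => ⟨h.1, fun j hj => ?_⟩) fun h => ⟨h.1, h.2.1, fun j hj hjR => ?_⟩
      · rcases eq_or_ne j k with rfl | hjk
        · by_contra hjR
          exact hR ⟨hjR, fun hlt => absurd hlt.1 (by omega)⟩
        · exact h.2 j (by omega)
      · rcases eq_or_ne j k with rfl | hjk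
        · by_contra hlt
          exact hR ⟨hjR, fun h' => h'.2 (not_le.1 hlt)⟩
        · exact h.2.2 j (by omega) hjR
  · simp only [Prog.bound, Test.cost, RExp.cost, NExp.cost]
    omega
  · rintro σ' ⟨-, hF, h4⟩
    refine ⟨hF, ?_⟩
    unfold Selected
    rwa [hF.nat (a := slotInRArr) (by decide), hF.real (b := keyArr) (by decide)]

theorem runs_lowerPrices {σ : Store} {m : ℕ} (hm : σ.nat sizeArr 1 = m) :
    Runs lowerPrices σ (100 * (m + 1)) fun σ' => Frame [slotArr] [priceArr, keyArr] σ σ' ∧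
      ∀ j < m,
        σ'.real priceArr j 0 = σ.real priceArr j 0 -
          (if σ.nat slotInRArr j ≠ 0 then σ.real deltaArr 0 0 else 0) ∧
        (σ.nat slotInRArr j ≠ 0 →
          σ'.real keyArr j 0 = σ.real keyArr j 0 - σ.real deltaArr 0 0) := by
  refine (runs_forLoop (N := m) (fun k σ' => σ'.nat slotArr 0 = k ∧
      Frame [slotArr] [priceArr, keyArr] σ σ' ∧
      ∀ j, σ'.real priceArr j 0 = σ.real priceArr j 0 -
          (if j < k ∧ σ.nat slotInRArr j ≠ 0 then σ.real deltaArr 0 0 else 0) ∧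
        σ'.real keyArr j 0 = σ.real keyArr j 0 -
          (if j < k ∧ σ.nat slotInRArr j ≠ 0 then σ.real deltaArr 0 0 else 0))
      ?_ ?_ fun k hkm σ' h => runs_of_wp ?_).mono ?_ ?_
  · rintro k σ' ⟨h1, hF, -⟩
    refine ⟨h1, ?_⟩
    rw [NExp.eval, hF.nat (by decide)]
    exact hm
  · exact ⟨by simp, (Frame.refl _ _ _).setNat (by decide) _ _, by simp⟩
  · obtain ⟨h1, hF, h4⟩ := h
    have e1 := hF.nat (a := slotInRArr) (by decide)
    have e3 := hF.real (b := deltaArr) (by decide)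
    have hother : ∀ j, j ≠ k → (j < k + 1 ↔ j < k) := fun j hj => by omega
    have hk := h4 k
    simp only [lt_irrefl, false_and, if_false, sub_zero] at hk
    simp only [Prog.wp, Test.Holds, RExp.eval, NExp.eval, Store.setReal_nat, h1, e1]
    rw [Store.setReal_real_of_ne (a := priceArr) (a' := keyArr) _ _ _ _ (by decide),
      Store.setReal_real_of_ne (a := priceArr) (a' := deltaArr) _ _ _ _ (by decide), e3,
      hk.1, hk.2]
    refine ⟨fun hR => ?_, fun hR => ?_⟩
    · refine ⟨trivial, by simp, ((hF.setReal (by decide) _ _ _).setReal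
        (by decide) _ _ _).setNat (by decide) _ _, fun j => ?_⟩
      rcases eq_or_ne j k with rfl | hjk
      · simp at hR
        simp [hR]
      · by_cases hlt : j < k <;> simpa [hjk, hother j hjk, hlt] using h4 j
    · refine ⟨trivial, by simp, hF.setNat (by decide) _ _, fun j => ?_⟩
      rcases eq_or_ne j k with rfl | hjk
      · simp at hR
        simpa [hR] using hk
      · by_cases hlt : j < k <;> simpa [hother j hjk, hlt] using h4 j
  · simp only [Prog.bound, Test.cost, RExp.cost, NExp.cost]
    omega
  · rintro σ' ⟨-, hF, h4⟩
    refine ⟨hF, fun j hj => ⟨?_, fun hR => ?_⟩⟩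
    · simpa only [hj, true_and] using (h4 j).1
    · rw [(h4 j).2, if_pos ⟨hj, hR⟩]

theorem runs_raiseUtilities {σ : Store} {n : ℕ} (hn : σ.nat sizeArr 0 = n) :
    Runs raiseUtilities σ (100 * (n + 1)) fun σ' => Frame [adArr] [utilityArr] σ σ' ∧
      ∀ i < n, σ'.real utilityArr i 0 = σ.real utilityArr i 0 +
        (if σ.nat adInRArr i ≠ 0 then σ.real deltaArr 0 0 else 0) := by
  refine (runs_forLoop (N := n) (fun k σ' => σ'.nat adArr 0 = k ∧
      Frame [adArr] [utilityArr] σ σ' ∧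
      ∀ i, σ'.real utilityArr i 0 = σ.real utilityArr i 0 +
        (if i < k ∧ σ.nat adInRArr i ≠ 0 then σ.real deltaArr 0 0 else 0))
      ?_ ?_ fun k hkn σ' h => runs_of_wp ?_).mono ?_ ?_
  · rintro k σ' ⟨h1, hF, -⟩
    refine ⟨h1, ?_⟩
    rw [NExp.eval, hF.nat (by decide)]
    exact hn
  · exact ⟨by simp, (Frame.refl _ _ _).setNat (by decide) _ _, by simp⟩
  · obtain ⟨h1, hF, h4⟩ := h
    have e1 := hF.nat (a := adInRArr) (by decide)
    have e3 := hF.real (b := deltaArr) (by decide)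
    have hother : ∀ j, j ≠ k → (j < k + 1 ↔ j < k) := fun j hj => by omega
    have hk := h4 k
    simp only [lt_irrefl, false_and, if_false, add_zero] at hk
    simp only [Prog.wp, Test.Holds, RExp.eval, NExp.eval, h1, e1, e3, hk]
    refine ⟨fun hR => ?_, fun hR => ?_⟩
    · refine ⟨h1, by simp, (hF.setReal (by decide) _ _ _).setNat (by decide) _ _, fun i => ?_⟩
      rcases eq_or_ne i k with rfl | hik
      · simp at hR
        simp [hR]
      · by_cases hlt : i < k <;> simpa [hik, hother i hik, hlt] using h4 i
    · refine ⟨trivial, by simp, hF.setNat (by decide) _ _, fun i => ?_⟩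
      rcases eq_or_ne i k with rfl | hik
      · simp at hR
        simpa [hR] using hk
      · by_cases hlt : i < k <;> simpa [hother i hik, hlt] using h4 i
  · simp only [Prog.bound, Test.cost, RExp.cost, NExp.cost]
    omega
  · rintro σ' ⟨-, hF, h4⟩
    refine ⟨hF, fun i hi => ?_⟩
    simpa only [hi, true_and] using h4 i

theorem runs_initSlots {σ : Store} {m : ℕ} (hm : σ.nat sizeArr 1 = m) :
    Runs initSlots σ (100 * (m + 1)) fun σ' => Frame [slotArr, slotInRArr] [keyArr] σ σ' ∧
      ∀ j < m,
        σ'.nat slotInRArr j = (if σ.nat slotMateArr j ≠ 0 then 1 else σ.nat slotInRArr j) ∧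
        (σ.nat slotMateArr j ≠ 0 → σ'.real keyArr j 0 = σ.real priceArr j 0) := by
  refine (runs_forLoop (N := m) (fun k σ' => σ'.nat slotArr 0 = k ∧
      Frame [slotArr, slotInRArr] [keyArr] σ σ' ∧
      ∀ j, σ'.nat slotInRArr j =
          (if j < k ∧ σ.nat slotMateArr j ≠ 0 then 1 else σ.nat slotInRArr j) ∧
        (j < k → σ.nat slotMateArr j ≠ 0 → σ'.real keyArr j 0 = σ.real priceArr j 0))
      ?_ ?_ fun k hkm σ' h => runs_of_wp ?_).mono ?_ ?_
  · rintro k σ' ⟨h1, hF, -⟩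
    refine ⟨h1, ?_⟩
    rw [NExp.eval, hF.nat (by decide)]
    exact hm
  · exact ⟨by simp, (Frame.refl _ _ _).setNat (by decide) _ _, by simp⟩
  · obtain ⟨h1, hF, h4⟩ := h
    have e1 := hF.nat (a := slotMateArr) (by decide)
    have e3 := hF.real (b := priceArr) (by decide)
    have hother : ∀ j, j ≠ k → (j < k + 1 ↔ j < k) := fun j hj => by omega
    have hk := h4 k
    simp only [lt_irrefl, false_and, if_false] at hk
    simp only [Prog.wp, Test.Holds, RExp.eval, NExp.eval, Store.setNat_real, h1, e1, e3,
      Store.setNat_nat_of_ne (a := slotInRArr) (a' := slotArr) _ _ _ (by decide)]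
    refine ⟨fun hR => ?_, fun hR => ?_⟩
    · refine ⟨by simpa using h1, by simp, ((hF.setNat (by decide) _ _).setReal
        (by decide) _ _ _).setNat (by decide) _ _, fun j => ?_⟩
      rcases eq_or_ne j k with rfl | hjk
      · simp at hR
        simp [hR]
      · by_cases hlt : j < k <;> simpa [hjk, hother j hjk, hlt] using h4 j
    · refine ⟨trivial, by simp, hF.setNat (by decide) _ _, fun j => ?_⟩
      rcases eq_or_ne j k with rfl | hjk
      · simp at hR
        simpa [hR] using hk
      · by_cases hlt : j < k <;> simpa [hother j hjk, hlt] using h4 j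
  · simp only [Prog.bound, Test.cost, RExp.cost, NExp.cost]
    omega
  · rintro σ' ⟨-, hF, h4⟩
    refine ⟨hF, fun j hj => ⟨?_, (h4 j).2 hj⟩⟩
    simpa only [hj, true_and] using (h4 j).1

end Specs

end Assignment

namespace Assignment

open RealRam

/-! ### One iteration on the machine and its cost -/

section Implementation

variable {n m : ℕ} {v : Fin n → Fin m → ℝ} {M : Fin n ≃. Fin m} {σ σ' : Store}
  {s s' : PState (Fin n) (Fin m)}

/-- The memory holds the instance and the state `s`, with explicit dual variables. -/
structure Models (σ : Store) (v : Fin n → Fin m → ℝ) (M : Fin n ≃. Fin m)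
    (s : PState (Fin n) (Fin m)) : Prop where
  numAds : σ.nat sizeArr 0 = n
  numSlots : σ.nat sizeArr 1 = m
  slotMate : ∀ {i j}, M i = some j → σ.nat slotMateArr j = i + 1
  weight : ∀ (i : Fin n) (j : Fin m), σ.real weightArr i j = v i j
  adInR : ∀ i : Fin n, σ.nat adInRArr i ≠ 0 ↔ i ∈ s.RU
  slotInR : ∀ j : Fin m, σ.nat slotInRArr j ≠ 0 ↔ j ∈ s.RV
  utility : ∀ i : Fin n, σ.real utilityArr i 0 = s.u i
  price : ∀ j : Fin m, σ.real priceArr j 0 = s.p j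
  pending : σ.real pendingArr 0 0 = 0

theorem Models.represents (h : Models σ v M s) : Represents σ s :=
  ⟨h.adInR, h.slotInR, fun i => by simp [h.utility, h.pending],
    fun j => by simp [h.price, h.pending]⟩

/-- Arrays numbered above these two thresholds are scratch space and carry no part of the state. -/
theorem Models.of_frame {A B : List ℕ} (h : Models σ v M s) (hF : Frame A B σ σ')
    (hA : ∀ a ∈ A, slotInRArr < a) (hB : ∀ b ∈ B, pendingArr < b) : Models σ' v M s := by
  have hn : ∀ {a}, a ≤ slotInRArr → σ'.nat a = σ.nat a := fun ha =>
    hF.nat fun h => absurd (hA _ h) (not_lt.2 ha)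
  have hr : ∀ {b}, b ≤ pendingArr → σ'.real b = σ.real b := fun hb =>
    hF.real fun h => absurd (hB _ h) (not_lt.2 hb)
  have e0 := hn (a := sizeArr) (by decide)
  have e1 := hn (a := slotMateArr) (by decide)
  have e2 := hn (a := adInRArr) (by decide)
  have e3 := hn (a := slotInRArr) (by decide)
  have e4 := hr (b := weightArr) (by decide)
  have e5 := hr (b := utilityArr) (by decide)
  have e6 := hr (b := priceArr) (by decide)
  have e7 := hr (b := pendingArr) (by decide)
  exact ⟨by rw [e0, h.numAds], by rw [e0, h.numSlots], fun hm => by rw [e1, h.slotMate hm],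
    fun i j => by rw [e4, h.weight], fun i => by rw [e2, h.adInR], fun j => by rw [e3, h.slotInR],
    fun i => by rw [e5, h.utility], fun j => by rw [e6, h.price], by rw [e7, h.pending]⟩

/-- The keys of the slots in `R` are correct. -/
def Keyed (σ : Store) (v : Fin n → Fin m → ℝ) (s : PState (Fin n) (Fin m)) : Prop :=
  ∀ j ∈ s.RV, IsLeast (slotCandidates v s j) (σ.real keyArr j 0)

/-- When `i` leaves `R`, exactly one candidate is added, the slack of the edge to `i`. This
justifies `relaxAll`. -/
theorem isLeast_slotCandidates_min {i : Fin n} {j : Fin m} {x : ℝ}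
    (h : IsLeast (slotCandidates v s j) x) (hu : s'.u = s.u) (hp : s'.p = s.p)
    (hR : ∀ i', i' ∉ s'.RU ↔ i' ∉ s.RU ∨ i' = i) :
    IsLeast (slotCandidates v s' j) (min x (s.u i + s.p j - v i j)) := by
  have e : slotCandidates v s' j = insert (s.u i + s.p j - v i j) (slotCandidates v s j) := by
    ext y
    simp only [slotCandidates, hu, hp, hR, Set.mem_ofPred_eq, Set.mem_insert_iff]
    constructor
    · rintro (h | ⟨i', hi' | rfl, h⟩)
      · exact Or.inr (Or.inl h)
      · exact Or.inr (Or.inr ⟨i', hi', h⟩)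
      · exact Or.inl h
    · rintro (h | h | ⟨i', hi', h⟩)
      · exact Or.inr ⟨i, Or.inr rfl, h⟩
      · exact Or.inl h
      · exact Or.inr ⟨i', Or.inl hi', h⟩
  rw [e, min_comm]
  exact h.insert _

/-- The memory is ready for the next iteration from state `s`. -/
structure Ready (σ : Store) (v : Fin n → Fin m → ℝ) (M : Fin n ≃. Fin m)
    (s : PState (Fin n) (Fin m)) : Prop where
  models : Models σ v M s
  keyed : Keyed σ v s
  selected : Selected m σ

theorem Ready.nonempty_iff (h : Ready σ v M s) : σ.nat bestArr 0 < m ↔ s.RV.Nonempty := by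
  rcases h.selected with ⟨h1, h2⟩ | ⟨h1, h2, -⟩
  · simp only [h1, lt_irrefl, false_iff, Set.not_nonempty_iff_eq_empty,
      Set.eq_empty_iff_forall_notMem, ← h.models.slotInR, not_not]
    exact fun j => h2 j j.2
  · exact iff_of_true h1 ⟨⟨_, h1⟩, (h.models.slotInR ⟨_, h1⟩).1 h2⟩

theorem Ready.exists_best (h : Ready σ v M s) (hb : σ.nat bestArr 0 < m) :
    ∃ d : Fin m, σ.nat bestArr 0 = d ∧ d ∈ s.RV ∧
      ∀ j ∈ s.RV, σ.real keyArr d 0 ≤ σ.real keyArr j 0 := by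
  rcases h.selected with ⟨h1, -⟩ | ⟨h1, h2, h3⟩
  · omega
  · exact ⟨⟨_, h1⟩, rfl, (h.models.slotInR ⟨_, h1⟩).1 h2,
      fun j hj => h3 j j.2 ((h.models.slotInR j).2 hj)⟩

theorem runs_shiftProg (h : Ready σ v M s) (hb : σ.nat bestArr 0 < m) :
    Runs shiftProg σ (100 * (n + m + 3)) fun σ' => Ready σ' v M (shift v s) := by
  obtain ⟨d, hd, hdR, hmin⟩ := h.exists_best hb
  -- The least of the slotwise minima is the minimum over all candidates.
  have hδ : delta v s = σ.real keyArr d 0 := by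
    refine IsLeast.csInf_eq ⟨mem_candidates.2 ⟨d, hdR, (h.keyed d hdR).1⟩, fun x hx => ?_⟩
    obtain ⟨j, hj, hx⟩ := mem_candidates.1 hx
    exact (hmin j hj).trans ((h.keyed j hj).2 hx)
  refine (Runs.seq (Q := fun σ₁ => Frame [] [deltaArr] σ σ₁ ∧
      σ₁.real deltaArr 0 0 = delta v s) (runs_of_wp ?_)
    fun σ₁ h₁ => Runs.seq (runs_lowerPrices (m := m) ?_)
      fun σ₂ h₂ => (runs_raiseUtilities (n := n) ?_).mono le_rfl fun σ₃ h₃ => ?_).mono ?_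
        fun _ => id
  · refine ⟨(Frame.refl _ _ _).setReal (by decide) _ _ _, ?_⟩
    simp [NExp.eval, RExp.eval, Store.setReal_real_self, hd, hδ]
  · rw [h₁.1.nat (by decide)]
    exact h.models.numSlots
  · rw [h₂.1.nat (by decide), h₁.1.nat (by decide)]
    exact h.models.numAds
  · obtain ⟨hF₁, hdelta⟩ := h₁
    obtain ⟨hF₂, hp⟩ := h₂
    obtain ⟨hF₃, hu⟩ := h₃
    have hn : ∀ {a}, a ≤ bestArr → σ₃.nat a = σ.nat a := fun {a} ha => by
      simp only [bestArr] at ha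
      rw [hF₃.nat (by simp [adArr]; omega), hF₂.nat (by simp [slotArr]; omega),
        hF₁.nat (by simp)]
    have hr : ∀ {b}, b ∉ [priceArr, utilityArr, keyArr, deltaArr] →
        σ₃.real b = σ.real b := fun {b} hb => by
      simp only [List.mem_cons, List.not_mem_nil, or_false, not_or] at hb
      rw [hF₃.real (by simp [hb]), hF₂.real (by simp [hb]), hF₁.real (by simp [hb])]
    have hslot : σ₁.nat slotInRArr = σ.nat slotInRArr := hF₁.nat (by decide)
    have hkey : ∀ j ∈ s.RV, σ₃.real keyArr j 0 = σ.real keyArr j 0 - delta v s := by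
      intro j hj
      rw [hF₃.real (by decide), (hp j j.2).2 (by rw [hslot]; exact (h.models.slotInR j).2 hj),
        hF₁.real (by decide), hdelta]
    refine ⟨⟨?_, ?_, fun hm => ?_, fun i j => ?_, fun i => ?_, fun j => ?_, fun i => ?_,
      fun j => ?_, ?_⟩, fun j hj => ?_, ?_⟩
    · rw [hn (by decide), h.models.numAds]
    · rw [hn (by decide), h.models.numSlots]
    · rw [hn (by decide), h.models.slotMate hm]
    · rw [hr (by decide), h.models.weight]
    · rw [hn (by decide)]
      exact h.models.adInR i
    · rw [hn (by decide)]
      exact h.models.slotInR j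
    · rw [hu i i.2, hF₂.real (b := utilityArr) (by decide), hF₁.real (b := utilityArr) (by decide),
        hF₂.nat (by decide), hF₁.nat (by decide), hF₂.real (by decide), hdelta, h.models.utility]
      have hi := h.models.adInR i
      by_cases hR : i ∈ s.RU
      · simp [shift, hR, hi.2 hR]
      · simp [shift, hR, not_not.1 (mt hi.1 hR)]
    · rw [hF₃.real (by decide), (hp j j.2).1, hF₁.real (b := priceArr) (by decide), hslot, hdelta,
        h.models.price]
      have hj := h.models.slotInR j
      by_cases hR : j ∈ s.RV
      · simp [shift, hR, hj.2 hR]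
      · simp [shift, hR, not_not.1 (mt hj.1 hR)]
    · rw [hr (by decide), h.models.pending]
    · have hj' : j ∈ s.RV := hj
      rw [hkey j hj]
      -- The shift translates all candidates of a slot in `R` by the same amount.
      have e : ∀ x, x ∈ slotCandidates v (shift v s) j ↔ x + delta v s ∈ slotCandidates v s j := by
        intro x
        simp only [slotCandidates, Set.mem_ofPred_eq, shift, hj', if_true]
        refine or_congr ⟨fun h => by linarith, fun h => by linarith⟩
          (exists_congr fun i => and_congr_right fun hi => ?_)
        rw [if_neg hi]
        exact ⟨fun h => by linarith, fun h => by linarith⟩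
      refine ⟨(e _).2 ?_, fun x hx => ?_⟩
      · rw [sub_add_cancel]
        exact (h.keyed j hj').1
      · have := (h.keyed j hj').2 ((e x).1 hx)
        linarith
    -- All keys in `R` fall equally, so the slot selected before is still least and no new scan is
    -- needed.
    · right
      rw [hn (by decide), hn (by decide), hd]
      refine ⟨d.2, (h.models.slotInR d).2 hdR, fun j hj hjR => ?_⟩
      have hj' := (h.models.slotInR ⟨j, hj⟩).1 hjR
      have h1 := hkey _ hj'
      have h2 := hkey _ hdR
      have h3 := hmin _ hj'
      simp only at h1 h2 h3
      rw [h1, h2]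
      linarith
  · simp only [Prog.bound, NExp.cost, RExp.cost]
    omega

theorem runs_removeStep (hfeas : IsFeasibleDual v s.u s.p) (hp : IsPartialPrune v M s s')
    (h : Ready σ v M s') (ht : removeTest.Holds σ) :
    Runs (Prog.seq removeBest (Prog.seq relaxAll selectMin)) σ (300 * (m + 1)) fun σ' =>
      ∃ s'', s''.RV.ncard + 1 = s'.RV.ncard ∧ IsPartialPrune v M s s'' ∧ Ready σ' v M s'' := by
  have hb : σ.nat bestArr 0 < m := by
    have := ht.1
    simpa only [Test.Holds, NExp.eval, h.models.numSlots] using this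
  obtain ⟨d, hd, hdR, hmin⟩ := h.exists_best hb
  have hkd : σ.real keyArr d 0 ≤ 0 := by
    have := ht.2
    simpa only [Test.Holds, NExp.eval, RExp.eval, hd, not_lt] using this
  obtain ⟨i, hiR, hm⟩ := hp.paired.exists_mate hdR
  -- The test gives that the least key is at most zero; feasibility gives the reverse inequality.
  have h0 : (0 : ℝ) ∈ slotCandidates v s' d := by
    have hle : 0 ≤ σ.real keyArr d 0 := by
      rcases (h.keyed d hdR).1 with hx | ⟨i', -, hx⟩
      · rw [hx, hp.p_eq]
        exact hfeas.2.2 d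
      · rw [hx, hp.p_eq, hp.u_eq]
        linarith [hfeas.1 i' d]
    exact le_antisymm hkd hle ▸ (h.keyed d hdR).1
  have hmate := h.models.slotMate hm
  refine (Runs.seq (Q := fun σ₁ => Frame [leavingArr, slotInRArr, adInRArr] [] σ σ₁ ∧
      Models σ₁ v M (s'.removePair i d) ∧ σ₁.nat leavingArr 0 = i) (runs_of_wp ?_)
    fun σ₁ h₁ => Runs.seq (runs_relaxAll (m := m) h₁.2.1.numSlots)
      fun σ₂ h₂ => (runs_selectMin (m := m) ?_).mono le_rfl fun σ₃ h₃ => ?_).mono ?_ fun _ => id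
  · have hfr : Frame [leavingArr, slotInRArr, adInRArr] []
        σ (((σ.setNat leavingArr 0 i).setNat slotInRArr d 0).setNat adInRArr i 0) :=
      (((Frame.refl _ _ _).setNat (by decide) _ _).setNat (by decide) _ _).setNat (by decide) _ _
    have hslots : ∀ k, (((σ.setNat leavingArr 0 i).setNat slotInRArr d 0).setNat
        adInRArr i 0).nat slotInRArr k = if k = d then 0 else σ.nat slotInRArr k := by
      intro k
      rw [Store.setNat_nat_of_ne _ _ _ (by decide), Store.setNat_nat_self,
        Store.setNat_nat_of_ne _ _ _ (by decide)]
    have hads : ∀ k, (((σ.setNat leavingArr 0 i).setNat slotInRArr d 0).setNat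
        adInRArr i 0).nat adInRArr k = if k = i then 0 else σ.nat adInRArr k := by
      intro k
      rw [Store.setNat_nat_self, Store.setNat_nat_of_ne _ _ _ (by decide),
        Store.setNat_nat_of_ne _ _ _ (by decide)]
    have hleave : (((σ.setNat leavingArr 0 i).setNat slotInRArr d 0).setNat
        adInRArr i 0).nat leavingArr 0 = i := by
      rw [Store.setNat_nat_of_ne _ _ _ (by decide), Store.setNat_nat_of_ne _ _ _ (by decide),
        Store.setNat_nat_self, if_pos rfl]
    simp only [removeBest, Prog.wp, NExp.eval, hd, hmate, Nat.add_sub_cancel,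
      Store.setNat_nat_of_ne (a := leavingArr) (a' := bestArr) _ _ _ (by decide),
      Store.setNat_nat_of_ne (a := slotInRArr) (a' := leavingArr) _ _ _ (by decide),
      Store.setNat_nat_self, if_true]
    refine ⟨hfr, ⟨?_, ?_, fun hm => ?_, h.models.weight, fun i' => ?_, fun j' => ?_,
      h.models.utility, h.models.price, h.models.pending⟩, hleave⟩
    · rw [hfr.nat (by decide), h.models.numAds]
    · rw [hfr.nat (by decide), h.models.numSlots]
    · rw [hfr.nat (by decide), h.models.slotMate hm]
    · rw [hads]
      simp only [PState.removePair, Set.mem_sdiff, Set.mem_singleton_iff, ← h.models.adInR,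
        Fin.ext_iff]
      split_ifs with he <;> simp [he]
    · rw [hslots]
      simp only [PState.removePair, Set.mem_sdiff, Set.mem_singleton_iff, ← h.models.slotInR,
        Fin.ext_iff]
      split_ifs with he <;> simp [he]
  · rw [h₂.1.nat (by decide)]
    exact h₁.2.1.numSlots
  · obtain ⟨hF₁, hM₁, hi₁⟩ := h₁
    obtain ⟨hF₂, hk⟩ := h₂
    refine ⟨s'.removePair i d, Set.ncard_sdiff_singleton_add_one hdR (Set.toFinite _),
      hp.removePair hm hdR h0, (hM₁.of_frame hF₂ (by decide) (by decide)).of_frame h₃.1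
        (by decide) (by decide), fun j hj => ?_, h₃.2⟩
    rw [h₃.1.real (by decide), hk j j.2 ((hM₁.slotInR j).2 hj), hi₁, hM₁.utility, hM₁.price,
      hM₁.weight, hF₁.real (by decide)]
    refine isLeast_slotCandidates_min (s := s') (h.keyed j hj.1) rfl rfl fun i' => ?_
    simp only [PState.removePair, Set.mem_sdiff, Set.mem_singleton_iff]
    tauto
  · simp only [removeBest, Prog.bound, NExp.cost]
    omega

theorem IsPartialPrune.ncard_le (hp : IsPartialPrune v M s s') :
    (prune v M s).RV.ncard ≤ s'.RV.ncard := by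
  refine Set.ncard_le_ncard (fun j hj => ?_) (Set.toFinite _)
  by_contra hj'
  exact hj.2 (hp.visited_slot hj.1 hj')

/-- `N` counts the visited slots still to be removed. No partial prune has fewer slots than the full
one, so for `N = 0` the test must fail; conversely a failing test means that the prune is complete.
-/
theorem runs_removeVisited (hfeas : IsFeasibleDual v s.u s.p) {N : ℕ}
    (hN : s'.RV.ncard = (prune v M s).RV.ncard + N) (hp : IsPartialPrune v M s s')
    (h : Ready σ v M s') :
    Runs removeVisited σ (400 * (m + 1) * N + 20) fun σ' => Ready σ' v M (prune v M s) := by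
  have hdone : ∀ {σ : Store} {s' : PState (Fin n) (Fin m)}, IsPartialPrune v M s s' →
      Ready σ v M s' → ¬ removeTest.Holds σ → s' = prune v M s := by
    intro σ s' hp h ht
    refine hp.eq_prune fun j hj x hx => ?_
    have hb := h.nonempty_iff.2 ⟨j, hj⟩
    obtain ⟨d, hd, hdR, hmin⟩ := h.exists_best hb
    have hpos : 0 < σ.real keyArr d 0 := by
      by_contra hneg
      refine ht ⟨?_, ?_⟩
      · simpa only [Test.Holds, NExp.eval, h.models.numSlots] using hb
      · simpa only [Test.Holds, NExp.eval, RExp.eval, hd] using hneg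
    exact hpos.trans_le ((hmin j hj).trans ((h.keyed j hj).2 hx))
  induction N generalizing σ s' with
  | zero =>
    by_cases ht : removeTest.Holds σ
    · obtain ⟨-, -, -, -, s'', hs'', hp'', -⟩ := runs_removeStep hfeas hp h ht
      have := hp''.ncard_le
      omega
    · exact (Runs.loopDone ht (hdone hp h ht ▸ h)).mono
        (by simp [removeTest, Test.cost, NExp.cost, RExp.cost]) fun _ => id
  | succ N ih =>
    by_cases ht : removeTest.Holds σ
    · refine (Runs.loopStep ht (runs_removeStep hfeas hp h ht) fun σ₁ h₁ => ?_).mono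
        (t := removeTest.cost + 300 * (m + 1) + (400 * (m + 1) * N + 20) + 1) ?_ fun _ => id
      · obtain ⟨s'', hs'', hp'', h''⟩ := h₁
        exact ih (by omega) hp'' h''
      · simp only [removeTest, Test.cost, NExp.cost, RExp.cost, Nat.mul_succ]
        omega
    · have := congrArg (fun s => s.RV.ncard) (hdone hp h ht)
      omega

/-- The potential `1000 * (n + m + 1)` per slot of `R` pays for the iteration: at least one slot
leaves, which covers the shift, and each removal costs `O(m)`. The `6` is for evaluating the loop
guard. -/
theorem runs_body (hinv : Invariant v M s) (h : Ready σ v M s) (hb : σ.nat bestArr 0 < m) :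
    ∃ σ' t, Exec priceLowering.body σ σ' t ∧ Ready σ' v M (iteration v M s) ∧
      t + 6 + 1000 * (n + m + 1) * (iteration v M s).RV.ncard ≤
        1000 * (n + m + 1) * s.RV.ncard := by
  have hne := h.nonempty_iff.1 hb
  have hlt := ncard_iteration_lt (v := v) (M := M) hne
  obtain ⟨N, hN⟩ := Nat.exists_eq_add_of_lt hlt
  have hinv' := hinv.shift hne
  obtain ⟨σ', t, he, hle, hr⟩ := (runs_shiftProg h hb).seq fun σ₁ h₁ =>
    runs_removeVisited hinv'.feasible (N := N + 1)
      (show (shift v s).RV.ncard = _ from hN.trans (add_assoc _ _ _))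
      (IsPartialPrune.refl hinv'.paired) h₁
  refine ⟨σ', t, he, hr, ?_⟩
  rw [hN]
  nlinarith

end Implementation

end Assignment

/-! ### Runs of the main loop with amortized cost -/

namespace RealRam

/-- An invariant that is maintained by `c` yields a run of `k` executions of `c`. -/
theorem exists_trace {c : Prog} {σ₀ : Store} {k e : ℕ} (P : ℕ → Store → Prop) (f : ℕ → ℕ)
    (h0 : P 0 σ₀)
    (hstep : ∀ r < k, ∀ σ, P r σ → ∃ σ' t, Exec c σ σ' t ∧ P (r + 1) σ' ∧ t + e + f (r + 1) ≤ f r) :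
    ∃ τ : ℕ → Store, τ 0 = σ₀ ∧ (∀ r ≤ k, P r (τ r)) ∧
      ∀ r < k, ∃ t, Exec c (τ r) (τ (r + 1)) t ∧ t + e + f (r + 1) ≤ f r := by
  choose! next time hnext using hstep
  let τ : ℕ → Store := fun r => Nat.rec σ₀ (fun r σ => next r σ) r
  have hP : ∀ r ≤ k, P r (τ r) := by
    intro r
    induction r with
    | zero => exact fun _ => h0
    | succ r ih => exact fun hr => (hnext r hr _ (ih (Nat.le_of_succ_le hr))).2.1
  exact ⟨τ, rfl, hP, fun r hr => ⟨_, (hnext r hr _ (hP r hr.le)).1, (hnext r hr _ (hP r hr.le)).2.2⟩⟩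

/-- The potential differences telescope; the last guard evaluation is paid separately. -/
theorem exists_exec_loop {b : Test} {c : Prog} {τ : ℕ → Store} {f : ℕ → ℕ} {k : ℕ}
    (hb : ∀ r < k, b.Holds (τ r)) (hk : ¬ b.Holds (τ k))
    (hstep : ∀ r < k, ∃ t, Exec c (τ r) (τ (r + 1)) t ∧ t + (b.cost + 1) + f (r + 1) ≤ f r) :
    ∃ T, Exec (Prog.loop b c) (τ 0) (τ k) T ∧ T ≤ f 0 + b.cost + 1 := by
  induction k generalizing τ f with
  | zero => exact ⟨_, Exec.loopDone hk, by omega⟩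
  | succ k ih =>
    obtain ⟨t, he, ht⟩ := hstep 0 k.succ_pos
    obtain ⟨T, hE, hT⟩ := ih (τ := fun r => τ (r + 1)) (f := fun r => f (r + 1))
      (fun r hr => hb _ (Nat.succ_lt_succ hr)) hk fun r hr => hstep _ (Nat.succ_lt_succ hr)
    refine ⟨_, Exec.loopStep (hb 0 k.succ_pos) he hE, ?_⟩
    simp only [Nat.zero_add] at ht hT
    omega

end RealRam

namespace Assignment

open RealRam

/-! ### Initialization -/

section Setup

variable {n m : ℕ} {v : Fin n → Fin m → ℝ} {M : Fin n ≃. Fin m} {u : Fin n → ℝ} {p : Fin m → ℝ}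

theorem inputStore_slotMate_ne_zero {j : Fin m} :
    (inputStore v M p).nat slotMateArr j ≠ 0 ↔ M.symm j ≠ none := by
  cases h : M.symm j <;> simp [inputStore, slotMateArr, adMateArr, sizeArr, h]

theorem inputStore_slotMate {i : Fin n} {j : Fin m} (hm : M i = some j) :
    (inputStore v M p).nat slotMateArr j = i + 1 := by
  simp [inputStore, slotMateArr, adMateArr, sizeArr, (PEquiv.eq_some_iff M).2 hm]

theorem inputStore_adMate (i : Fin n) :
    (inputStore v M p).nat adMateArr i = (M i).elim 0 (fun j => (j : ℕ) + 1) := by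
  simp [inputStore, adMateArr, sizeArr]

theorem inputStore_numAds : (inputStore v M p).nat sizeArr 0 = n := by
  simp [inputStore]

theorem inputStore_numSlots : (inputStore v M p).nat sizeArr 1 = m := by
  simp [inputStore]

theorem inputStore_weight (i : Fin n) (j : Fin m) :
    (inputStore v M p).real weightArr i j = v i j := by
  simp [inputStore]

theorem inputStore_price (j : Fin m) : (inputStore v M p).real priceArr j 0 = p j := by
  simp [inputStore, priceArr, weightArr]

theorem inputStore_real_eq_zero {a : ℕ} (ha : priceArr < a) (k l : ℕ) :
    (inputStore v M p).real a k l = 0 := by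
  simp only [priceArr] at ha
  simp [inputStore, priceArr, weightArr, show a ≠ 0 by omega, show a ≠ 1 by omega]

theorem inputStore_nat_eq_zero {a : ℕ} (ha : slotMateArr < a) (k : ℕ) :
    (inputStore v M p).nat a k = 0 := by
  simp only [slotMateArr] at ha
  simp [inputStore, sizeArr, adMateArr, slotMateArr, show a ≠ 0 by omega, show a ≠ 1 by omega,
    show a ≠ 2 by omega]

/-- The starting state, with the unmatched ads from number `k` on still in `R`. -/
def startStateFrom (M : Fin n ≃. Fin m) (u : Fin n → ℝ) (p : Fin m → ℝ) (k : ℕ) :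
    PState (Fin n) (Fin m) where
  u := u
  p := p
  RU := {i | M i ≠ none ∨ k ≤ i}
  RV := {j | M.symm j ≠ none}

/-- The invariant regards the unmatched ads not yet processed as members of `R`. Passing a matched
ad does not change this auxiliary state; passing an unmatched one is a removal from `R`, handled by
`relaxAll`. -/
theorem runs_initAds (hs : CompSlack v M u p) {σ : Store}
    (hF : Frame [slotArr, slotInRArr] [keyArr] (inputStore v M p) σ)
    (hR : ∀ j : Fin m, σ.nat slotInRArr j ≠ 0 ↔ M.symm j ≠ none)
    (hk : Keyed σ v (startStateFrom M u p 0)) :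
    Runs initAds σ ((100 * (m + 1) + 100) * (n + 1)) fun σ' =>
      Models σ' v M (startState M u p) ∧ Keyed σ' v (startState M u p) := by
  refine (runs_forLoop (N := n) (t := 100 * (m + 1) + 50) (fun k σ' => σ'.nat adArr 0 = k ∧
      Frame [adArr, slotArr, slotInRArr, adInRArr, leavingArr] [utilityArr, keyArr]
        (inputStore v M p) σ' ∧
      (∀ j : Fin m, σ'.nat slotInRArr j ≠ 0 ↔ M.symm j ≠ none) ∧
      (∀ i : Fin n, σ'.nat adInRArr i ≠ 0 ↔ i < k ∧ M i ≠ none) ∧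
      (∀ i : Fin n, σ'.real utilityArr i 0 = if i < k then u i else 0) ∧
      Keyed σ' v (startStateFrom M u p k)) ?_ ?_ fun k hkn σ' h => ?_).mono ?_ ?_
  · rintro k σ' ⟨h1, hF, -⟩
    refine ⟨h1, ?_⟩
    rw [NExp.eval, hF.nat (by decide)]
    exact inputStore_numAds
  · refine ⟨by simp [Store.setNat_nat_self], (hF.mono (by decide) (by decide)).setNat (by decide) _ _,
      fun j => ?_, fun i => ?_, fun i => ?_, hk⟩
    · rw [Store.setNat_nat_of_ne _ _ _ (by decide)]
      exact hR j
    · rw [Store.setNat_nat_of_ne _ _ _ (by decide), hF.nat (by decide),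
        inputStore_nat_eq_zero (by decide)]
      simp
    · rw [Store.setNat_real, hF.real (by decide), inputStore_real_eq_zero (by decide)]
      simp
  · obtain ⟨h1, hF', hR', hA, hu, hkey⟩ := h
    let i₀ : Fin n := ⟨k, hkn⟩
    have hother : ∀ i : Fin n, (i : ℕ) ≠ k → ((i : ℕ) < k + 1 ↔ (i : ℕ) < k) :=
      fun i hi => by omega
    have hmate : (inputStore v M p).nat adMateArr k = (M i₀).elim 0 (fun j => (j : ℕ) + 1) :=
      inputStore_adMate i₀
    have e1 : σ'.nat adMateArr = (inputStore v M p).nat adMateArr := hF'.nat (by decide)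
    have e2 : σ'.real weightArr = (inputStore v M p).real weightArr := hF'.real (by decide)
    have e3 : σ'.real priceArr = (inputStore v M p).real priceArr := hF'.real (by decide)
    refine (Runs.branch (t := 100 * (m + 1) + 40) (fun hb => ?_) fun hb => ?_).mono ?_
      fun _ => id
    · simp only [Test.Holds, NExp.eval, h1, e1, hmate] at hb
      obtain ⟨j, hj⟩ : ∃ j, M i₀ = some j := by
        cases h : M i₀ with
        | none => simp [h] at hb
        | some j => exact ⟨j, rfl⟩
      rw [hj] at hmate
      refine (runs_of_wp ?_).mono ?_ fun _ => id
      · have hval : v i₀ j - p j = u i₀ := by linarith [hs.edge hj]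
        have hw := inputStore_weight (v := v) (M := M) (p := p) i₀ j
        simp only [Prog.wp, NExp.eval, RExp.eval, Store.setNat_real, h1, e1, hmate,
          Store.setNat_nat_of_ne (a := adInRArr) (a' := adArr) _ _ _ (by decide),
          Store.setNat_nat_of_ne (a := adInRArr) (a' := adMateArr) _ _ _ (by decide),
          Option.elim_some, Nat.add_sub_cancel, e2, e3, inputStore_price]
        rw [show (inputStore v M p).real weightArr k j = v i₀ j from hw, hval]
        refine ⟨?_, ?_, ((hF'.setNat (by decide) _ _).setReal (by decide) _ _ _).setNat
          (by decide) _ _, fun j' => ?_, fun i => ?_, fun i => ?_, fun j' hj' => ?_⟩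
        · rw [Store.setReal_nat, Store.setNat_nat_of_ne _ _ _ (by decide), h1]
        · rw [Store.setNat_nat_self, if_pos rfl]
        · rw [Store.setNat_nat_of_ne _ _ _ (by decide), Store.setReal_nat,
            Store.setNat_nat_of_ne _ _ _ (by decide)]
          exact hR' j'
        · rw [Store.setNat_nat_of_ne _ _ _ (by decide), Store.setReal_nat, Store.setNat_nat_self]
          by_cases hi : (i : ℕ) = k
          · obtain rfl : i = i₀ := Fin.ext hi
            simp [hi, hj]
          · simpa [hi, hother i hi] using hA i
        · rw [Store.setReal_real_self, Store.setNat_real]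
          by_cases hi : (i : ℕ) = k
          · obtain rfl : i = i₀ := Fin.ext hi
            simp [hi]
          · simpa [hi, hother i hi] using hu i
        · have e : startStateFrom M u p (k + 1) = startStateFrom M u p k := by
            simp only [startStateFrom, PState.mk.injEq, true_and, and_true]
            ext i
            by_cases hi : (i : ℕ) = k
            · obtain rfl : i = i₀ := Fin.ext hi
              simp [hj]
            · have : k + 1 ≤ (i : ℕ) ↔ k ≤ (i : ℕ) := by omega
              simp only [Set.mem_ofPred_eq, this]
          rw [e] at hj' ⊢
          rw [Store.setNat_real, Store.setReal_real_of_ne _ _ _ _ (by decide)]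
          exact hkey j' hj'
      · simp only [Prog.bound, NExp.cost, RExp.cost]
        omega
    · simp only [Test.Holds, NExp.eval, h1, e1, hmate] at hb
      have hi₀ : M i₀ = none := by
        cases h : M i₀ with
        | none => rfl
        | some j => simp [h] at hb
      refine (Runs.seq (Q := fun σ₁ => Frame [leavingArr] [] σ' σ₁ ∧ σ₁.nat leavingArr 0 = k)
        (runs_of_wp ?_) fun σ₁ h₁ => (runs_relaxAll (m := m) ?_).mono le_rfl
          fun σ₂ h₂ => ?_).mono ?_ fun _ => id
      · refine ⟨(Frame.refl _ _ _).setNat (by decide) _ _, ?_⟩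
        simp only [NExp.eval, Store.setNat_nat_self, if_true, h1]
      · rw [h₁.1.nat (by decide), hF'.nat (by decide)]
        exact inputStore_numSlots
      · obtain ⟨hF₁, hl⟩ := h₁
        obtain ⟨hF₂, hk₂⟩ := h₂
        have hA' : σ₂.nat adInRArr = σ'.nat adInRArr := by
          rw [hF₂.nat (by decide), hF₁.nat (by decide)]
        have hS' : σ₂.nat slotInRArr = σ'.nat slotInRArr := by
          rw [hF₂.nat (by decide), hF₁.nat (by decide)]
        refine ⟨?_, ?_, ((hF'.trans (hF₁.mono (by decide) (by decide))).trans
          (hF₂.mono (by decide) (by decide))).setNat (by decide) _ _, fun j' => ?_, fun i => ?_,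
          fun i => ?_, fun j' hj' => ?_⟩
        · rw [hF₂.nat (by decide), hF₁.nat (by decide), h1]
        · rw [Store.setNat_nat_self, if_pos rfl]
        · rw [Store.setNat_nat_of_ne _ _ _ (by decide), hS']
          exact hR' j'
        · rw [Store.setNat_nat_of_ne _ _ _ (by decide), hA', hA]
          by_cases hi : (i : ℕ) = k
          · obtain rfl : i = i₀ := Fin.ext hi
            simp [hi₀]
          · simp [hother i hi]
        · rw [Store.setNat_real, hF₂.real (by decide), hF₁.real (by decide), hu]
          by_cases hi : (i : ℕ) = k
          · obtain rfl : i = i₀ := Fin.ext hi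
            simp [hs.ad hi₀]
          · simp [hother i hi]
        -- The cell still holds its initial `0`, which is the utility of an unmatched ad.
        · have hui : σ'.real utilityArr k 0 = u i₀ := by
            have := hu i₀
            simp only [i₀, lt_irrefl, if_false] at this
            rw [this, hs.ad hi₀]
          rw [Store.setNat_real, hk₂ j' j'.2 (by
            rw [hF₁.nat (by decide)]
            exact (hR' j').2 hj'), hl, hF₁.real (by decide), hF₁.real (by decide),
            hF₁.real (by decide), hF₁.real (by decide), hui, e2, e3, inputStore_price,
            show (inputStore v M p).real weightArr k j' = v i₀ j' from inputStore_weight i₀ j']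
          refine isLeast_slotCandidates_min (s := startStateFrom M u p k) (hkey j' hj') rfl rfl
            fun i => ?_
          simp only [startStateFrom, Set.mem_ofPred_eq, not_or, not_not, not_le]
          by_cases hi : (i : ℕ) = k
          · obtain rfl : i = i₀ := Fin.ext hi
            simp [hi₀, i₀]
          · have : i ≠ i₀ := fun h => hi (congrArg Fin.val h)
            simp [hother i hi, this]
      · simp only [Prog.bound, NExp.cost]
        omega
    · simp only [Test.cost, NExp.cost]
      omega
  · simp only [NExp.cost]
    nlinarith
  · rintro σ' ⟨-, hF', hR', hA, hu, hkey⟩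
    refine ⟨⟨?_, ?_, fun hm => ?_, fun i j => ?_, fun i => ?_, hR', fun i => ?_, fun j => ?_, ?_⟩,
      fun j hj => ?_⟩
    · rw [hF'.nat (by decide), inputStore_numAds]
    · rw [hF'.nat (by decide), inputStore_numSlots]
    · rw [hF'.nat (by decide), inputStore_slotMate hm]
    · rw [hF'.real (by decide), inputStore_weight]
    · rw [hA]
      simp [startState]
    · rw [hu, if_pos i.2]
      rfl
    · rw [hF'.real (by decide), inputStore_price]
      rfl
    · rw [hF'.real (by decide), inputStore_real_eq_zero (by decide)]
    · have e : startStateFrom M u p n = startState M u p := by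
        simp only [startStateFrom, startState, PState.mk.injEq, true_and, and_true]
        ext i
        simp [i.2]
      rw [← e] at hj ⊢
      exact hkey j hj

theorem runs_setup (hs : CompSlack v M u p) :
    Runs priceLowering.setup (inputStore v M p) (400 * (m + 1) * (n + 1)) fun σ =>
      Ready σ v M (startState M u p) := by
  refine (Runs.seq (runs_initSlots (m := m) inputStore_numSlots) fun σ₁ h₁ =>
    Runs.seq (runs_initAds (u := u) hs h₁.1 ?_ ?_) fun σ₂ h₂ =>
      (runs_selectMin (m := m) h₂.1.numSlots).mono le_rfl fun σ₃ h₃ => ?_).mono ?_ fun _ => id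
  · intro j
    rw [(h₁.2 j j.2).1, ← inputStore_slotMate_ne_zero (v := v) (p := p),
      inputStore_nat_eq_zero (a := slotInRArr) (by decide)]
    split_ifs with h <;> simp [h]
  · intro j hj
    rw [(h₁.2 j j.2).2 (inputStore_slotMate_ne_zero.2 hj), inputStore_price]
    -- At `k = 0` no ad is outside `R`, so the price is the only candidate.
    refine ⟨Or.inl rfl, ?_⟩
    rintro x (rfl | ⟨i, hi, -⟩)
    · exact le_rfl
    · simp [startStateFrom] at hi
  · refine ⟨h₂.1.of_frame h₃.1 (by decide) (by simp), fun j hj => ?_, h₃.2⟩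
    rw [h₃.1.real (by simp)]
    exact h₂.2 j hj
  · nlinarith

/-- The mates inject the matched slots into the ads. Having both bounds makes `(n + m) * |R|` of
order `n * m`. -/
theorem ncard_startState_le (u : Fin n → ℝ) (p : Fin m → ℝ) :
    (startState M u p).RV.ncard ≤ n ∧ (startState M u p).RV.ncard ≤ m := by
  constructor
  · choose g hg using fun j : (startState M u p).RV =>
      (paired_startState (M := M) u p).exists_mate j.2
    have hinj : Function.Injective g := by
      intro j j' h
      have h1 := (hg j).2
      rw [h, (hg j').2, Option.some_inj] at h1
      exact Subtype.ext h1.symm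
    simpa [Set.ncard] using Nat.card_le_card_of_injective g hinj
  · simpa using Set.ncard_le_card (startState M u p).RV

end Setup

end Assignment

/-! ### The main theorem -/

open Assignment RealRam
/-- Price lowering computes the VCG prices, which are the pointwise least optimal dual prices, and
has an implementation that runs in time `O(|E| + |V| log |E|)`, where `|E| = n * m`, `|V| = m`. -/
theorem theorem2 :
    ∃ (A : LoopProgram) (C : ℝ), ∀ (n m : ℕ), 0 < n → 0 < m →
      ∀ (v : Fin n → Fin m → ℝ), (∀ i j, 0 ≤ v i j) →
      ∀ (M : Fin n ≃. Fin m), IsOptimalMatching v M →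
      ∀ (u : Fin n → ℝ) (p : Fin m → ℝ), IsOptimalDual v u p →
        IsLeast {p' | IsShadowPrices v p'} (vcgPrice v M) ∧
        ∃ (k : ℕ) (out : Store) (T : ℕ),
          StopsAfter v M u p k ∧
          (stateAfter v M u p k).p = vcgPrice v M ∧
          A.Simulates (inputStore v M p) out k (stateAfter v M u p) ∧
          Exec A.program (inputStore v M p) out T ∧
          (∀ j : Fin m, out.real priceArr j 0 = vcgPrice v M j) ∧
          (T : ℝ) ≤ C * ((n * m : ℕ) + m * Real.log (n * m : ℕ)) := by
  refine ⟨priceLowering, 5000, fun n m hn hm v _ M hM u p h => ?_⟩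
  have : Nonempty (Fin n) := ⟨⟨0, hn⟩⟩
  have : Nonempty (Fin m) := ⟨⟨0, hm⟩⟩
  obtain ⟨k, hk⟩ := exists_stopsAfter hM h
  have hinv : ∀ r ≤ k, Invariant v M (stateAfter v M u p r) := fun r hr =>
    invariant_stateAfter hM h fun r' hr' => hk.1 r' (hr'.trans_le hr)
  have hguard : ∀ r ≤ k, ∀ σ, Ready σ v M (stateAfter v M u p r) →
      (σ.nat bestArr 0 < m ↔ ¬ (stateAfter v M u p r).Done) := fun r hr σ hσ => by
    rw [hσ.nonempty_iff, (hinv r hr).paired.done_iff, Set.nonempty_iff_ne_empty]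
  have hholds : ∀ r ≤ k, ∀ σ, Ready σ v M (stateAfter v M u p r) →
      (priceLowering.guard.Holds σ ↔ ¬ (stateAfter v M u p r).Done) := fun r hr σ hσ => by
    rw [← hguard r hr σ hσ]
    simp only [priceLowering, Test.Holds, NExp.eval, hσ.models.numSlots]
  obtain ⟨σ₀, t₀, he₀, ht₀, hr₀⟩ := runs_setup (u := u) (h.compSlack hM)
  obtain ⟨τ, rfl, hτ, hstep⟩ := exists_trace (c := priceLowering.body) (k := k) (e := 6)
    (fun r σ => Ready σ v M (stateAfter v M u p r))
    (fun r => 1000 * (n + m + 1) * (stateAfter v M u p r).RV.ncard) hr₀ (by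
      intro r hr σ hσ
      rw [stateAfter_succ]
      exact runs_body (hinv r hr.le) hσ ((hguard r hr.le σ hσ).2 (hk.1 r hr)))
  have hg : ∀ r < k, priceLowering.guard.Holds (τ r) := fun r hr =>
    (hholds r hr.le _ (hτ r hr.le)).2 (hk.1 r hr)
  have hgk : ¬ priceLowering.guard.Holds (τ k) := fun hg =>
    (hholds k le_rfl _ (hτ k le_rfl)).1 hg hk.2
  obtain ⟨T, hT, hTle⟩ := exists_exec_loop (f := fun r =>
    1000 * (n + m + 1) * (stateAfter v M u p r).RV.ncard) hg hgk hstep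
  refine ⟨isLeast_vcgPrice hM, k, τ k, t₀ + (T + 1), hk, hk.price_eq hM h,
    ⟨τ, ⟨t₀, he₀⟩, fun r hr => ⟨hg r hr, ?_⟩, hgk, ⟨1, Exec.skip _⟩,
      fun r hr => (hτ r hr).models.represents⟩,
    he₀.seq (hT.seq (Exec.skip _)), fun j => ?_, ?_⟩
  · obtain ⟨t, ht, -⟩ := hstep r hr
    exact ⟨t, ht⟩
  · rw [(hτ k le_rfl).models.price, hk.price_eq hM h]
  · obtain ⟨hcn, hcm⟩ := ncard_startState_le (M := M) u p
    have hcost : priceLowering.guard.cost = 5 := rfl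
    -- The setup costs at most `1600 * (n * m)`. In the potential, each of `n`, `m` and `1` times
    -- the number of matched slots is at most `n * m`, which gives `3000 * (n * m)`; a few units
    -- remain.
    have hbound : t₀ + (T + 1) ≤ 5000 * (n * m) := by
      rw [hcost] at hTle
      change T ≤ 1000 * (n + m + 1) * (startState M u p).RV.ncard + 5 + 1 at hTle
      nlinarith [Nat.mul_le_mul_left n hcm, Nat.mul_le_mul_left m hcn, Nat.mul_pos hn hm,
        Nat.mul_le_mul hn hm, Nat.mul_le_mul_left n hm, Nat.mul_le_mul_right m hn]
    have hlog : 0 ≤ (m : ℝ) * Real.log (n * m : ℕ) :=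
      mul_nonneg m.cast_nonneg (Real.log_natCast_nonneg _)
    have : ((t₀ + (T + 1) : ℕ) : ℝ) ≤ 5000 * ((n * m : ℕ) : ℝ) := by exact_mod_cast hbound
    linarith
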